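/- Let $k$ be a commutative ring and let $\mathcal{A}=(A=\bigoplus_{i\in\mathbb{Z}}A^i,d)$ be a differential graded (dg) $k$-algebra such that $A^i=0$ for $i<0$, the ring $A^0$ is semisimple, and $d(A^0)=0$. Put $A^+=\bigoplus_{i>0}A^i$. All dg modules are right dg modules over $\mathcal{A}$; $\mathrm{dgMod}$ is the category of dg modules (morphisms are $A$-linear of degree $0$ and commute with $d$), $\mathrm{dgHot}$ its homotopy category, and $\{n\}$ is the shift, $(\{n\}M)^i=M^{i+n}$, $d_{\{n\}M}=(-1)^n d_M$. Let $\mathrm{dgPer}\subset\mathrm{dgHot}$ be the smallest strict full triangulated subcategory that contains $\mathcal{A}$ and is closed under direct summands. For a dg module $M$ let $\overline M=M/MA^+=M\otimes_A A^0$ with the induced differential, $H(\overline M)$ its cohomology, and $M_{\le i}=\sum_{j\le i}M^jA$; $\lambda$ denotes the length (in $\mathbb{N}\cup\{\infty\}$) of a right $A^0$-module. For a simple right $A^0$-module $L$, placed in degree $0$, let $\hat L=L\otimes_{A^0}A$ with differential $l\otimes a\mapsto l\otimes d(a)$. Let $\mathrm{dgFilt}$ be the class of dg modules $M$ that have a finite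 filtration $0=F_0\subset F_1\subset\dots\subset F_n=M$ by dg submodules with $F_i/F_{i-1}\cong\{l_i\}\hat L_i$ in $\mathrm{dgMod}$ for simple right $A^0$-modules $L_i$ and integers $l_1\ge l_2\ge\dots\ge l_n$. A dg module $M$ is homotopically minimal if every endomorphism of $M$ in $\mathrm{dgMod}$ that is a homotopy equivalence is an isomorphism. A dg module $M$ is bounded below if $M^i=0$ for all $i\ll 0$. Let $M$ be in $\mathrm{dgPer}$ and consider the conditions: 1. $M$ is in $\mathrm{dgFilt}$; 2. $M$ is homotopically minimal; 3. $d(M_{\le i})\subset M_{\le i}$ for all $i\in\mathbb{Z}$; 4. $d(M)\subset MA^+$; 5. $\overline M$ has differential $0$; 6. $\lambda(\overline M)=\lambda(H(\overline M))$; 7. $\lambda(\overline M)$ is finite, and $\lambda(\overline M)\le\lambda(\overline N)$ for every dg module $N$ isomorphic to $M$ in $\mathrm{dgHot}$. Then: - if $M$ is bounded below, the conditions 1–7 are equivalent; - for every $M$ in $\mathrm{dgPer}$, bounded below or not, 1 and 2 are equivalent, 3–7 are equivalent, and 1 implies that $M$ is bounded below and that 3 holds. -/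

import Mathlib

open scoped TensorProduct DirectSum

universe w u

noncomputable section

/-! ### Differential graded algebras and right differential graded modules -/

/-- A differential graded `k`-algebra structure on the `k`-algebra `A`: a `ℤ`-grading
`A = ⨁ i, A^i` as an algebra and a `k`-linear differential of degree one which satisfies the
graded Leibniz rule `d(ab) = d(a) b + (-1)^i a d(b)` for `a ∈ A^i`. -/
structure DGAlgebra (k : Type w) (A : Type u) [CommRing k] [Ring A] [Algebra k A] where
  gr : ℤ → Submodule k A
  graded : GradedAlgebra gr
  d : A →ₗ[k] A
  d_mem : ∀ (i : ℤ) (a : A), a ∈ gr i → d a ∈ gr (i + 1)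
  d_d : ∀ a : A, d (d a) = 0
  leibniz : ∀ (i : ℤ) (a b : A), a ∈ gr i → d (a * b) = d a * b + i.negOnePow • (a * d b)

attribute [instance] DGAlgebra.graded

variable {k : Type w} {A : Type u} [CommRing k] [Ring A] [Algebra k A]

/-- The degree zero part `A^0`, a subring of `A`. -/
def DGAlgebra.A0 (𝒜 : DGAlgebra k A) : Type u := ↥(SetLike.GradeZero.subring 𝒜.gr)

instance (𝒜 : DGAlgebra k A) : Ring 𝒜.A0 :=
  inferInstanceAs (Ring ↥(SetLike.GradeZero.subring 𝒜.gr))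

/-- The inclusion of rings `A^0 → A`. -/
def DGAlgebra.A0incl (𝒜 : DGAlgebra k A) : 𝒜.A0 →+* A :=
  (SetLike.GradeZero.subring 𝒜.gr).subtype

theorem DGAlgebra.A0incl_mem (𝒜 : DGAlgebra k A) (r : 𝒜.A0) : 𝒜.A0incl r ∈ 𝒜.gr 0 :=
  r.2

/-- A (right) dg module over `𝒜`. Right modules over `A` are modules over `Aᵐᵒᵖ`, so that
`MulOpposite.op a • m` is the product `m a`. The differential satisfies
`d(ma) = d(m) a + (-1)^i m d(a)` for `m ∈ M^i`. -/
structure DGModule (𝒜 : DGAlgebra k A) where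
  carrier : Type u
  [addCommGroup : AddCommGroup carrier]
  [module : Module Aᵐᵒᵖ carrier]
  gr : ℤ → AddSubgroup carrier
  internal : DirectSum.IsInternal gr
  smul_mem : ∀ (i j : ℤ) (m : carrier) (a : A), m ∈ gr i → a ∈ 𝒜.gr j →
    MulOpposite.op a • m ∈ gr (i + j)
  d : carrier →+ carrier
  d_mem : ∀ (i : ℤ) (m : carrier), m ∈ gr i → d m ∈ gr (i + 1)
  d_d : ∀ m : carrier, d (d m) = 0
  leibniz : ∀ (i : ℤ) (m : carrier) (a : A), m ∈ gr i →
    d (MulOpposite.op a • m) =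
      MulOpposite.op a • d m + i.negOnePow • (MulOpposite.op (𝒜.d a) • m)

attribute [instance] DGModule.addCommGroup DGModule.module

/-- A criterion for an internal grading: there are projections to the pieces. -/
theorem DGModule.isInternal_of_proj {X : Type*} [AddCommGroup X] (gr : ℤ → AddSubgroup X)
    (p : ℤ → X →+ X) (hsame : ∀ i, ∀ x ∈ gr i, p i x = x)
    (hne : ∀ i j, i ≠ j → ∀ x ∈ gr i, p j x = 0) (htop : ∀ x, x ∈ ⨆ i, gr i) :
    DirectSum.IsInternal gr := by
  have key : ∀ (x : ⨁ i, gr i) (j : ℤ), p j (DirectSum.coeAddMonoidHom gr x) = x j := by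
    intro x j
    induction x using DirectSum.induction_on with
    | zero => simp
    | of i y =>
      rw [DirectSum.coeAddMonoidHom_of]
      by_cases h : i = j
      · subst h
        rw [hsame _ _ y.2, DirectSum.of_eq_same]
      · rw [hne i j h _ y.2, DirectSum.of_eq_of_ne _ _ _ (Ne.symm h)]
        rfl
    | add x y hx hy => simp [hx, hy]
  constructor
  · refine (injective_iff_map_eq_zero (DirectSum.coeAddMonoidHom gr)).2 fun x hx => ?_
    refine DFinsupp.ext fun j => Subtype.ext ?_
    have := key x j
    rw [hx, map_zero] at this
    exact this.symm
  · intro x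
    have h : (⨆ i, gr i) ≤ (DirectSum.coeAddMonoidHom gr).range := by
      refine iSup_le fun i y hy => ?_
      exact ⟨DirectSum.of (fun i => gr i) i ⟨y, hy⟩, DirectSum.coeAddMonoidHom_of gr i ⟨y, hy⟩⟩
    exact h (htop x)

namespace DGAlgebra

variable (𝒜 : DGAlgebra k A)

/-- The projection of `A` to its homogeneous component of degree `i`. -/
def proj (i : ℤ) : A →+ A where
  toFun a := (DirectSum.decompose 𝒜.gr a i : A)
  map_zero' := by simp
  map_add' := by simp

theorem proj_same {i : ℤ} {a : A} (h : a ∈ 𝒜.gr i) : 𝒜.proj i a = a :=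
  DirectSum.decompose_of_mem_same _ h

theorem proj_ne {i j : ℤ} (hij : i ≠ j) {a : A} (h : a ∈ 𝒜.gr i) : 𝒜.proj j a = 0 :=
  DirectSum.decompose_of_mem_ne _ h hij

theorem induction {P : A → Prop} (h0 : P 0) (hom : ∀ i, ∀ a ∈ 𝒜.gr i, P a)
    (add : ∀ a b, P a → P b → P (a + b)) (a : A) : P a :=
  DirectSum.Decomposition.inductionOn 𝒜.gr h0 (fun m => hom _ m m.2) add a

end DGAlgebra

namespace DGModule

variable {𝒜 : DGAlgebra k A}

/-- The projection of `M` to its homogeneous component of degree `i`. -/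
def proj (M : DGModule 𝒜) (i : ℤ) : M.carrier →+ M.carrier :=
  letI := M.internal.chooseDecomposition
  { toFun := fun m => (DirectSum.decompose M.gr m i : M.carrier)
    map_zero' := by simp
    map_add' := by simp }

theorem proj_same (M : DGModule 𝒜) {i : ℤ} {m : M.carrier} (h : m ∈ M.gr i) :
    M.proj i m = m :=
  let _ := M.internal.chooseDecomposition
  DirectSum.decompose_of_mem_same _ h

theorem proj_ne (M : DGModule 𝒜) {i j : ℤ} (hij : i ≠ j) {m : M.carrier} (h : m ∈ M.gr i) :
    M.proj j m = 0 :=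
  let _ := M.internal.chooseDecomposition
  DirectSum.decompose_of_mem_ne _ h hij

theorem proj_mem (M : DGModule 𝒜) (i : ℤ) (m : M.carrier) : M.proj i m ∈ M.gr i :=
  letI := M.internal.chooseDecomposition
  (DirectSum.decompose M.gr m i).2

theorem exists_sum_proj (M : DGModule 𝒜) (m : M.carrier) :
    ∃ s : Finset ℤ, ∑ i ∈ s, M.proj i m = m := by
  classical
  letI := M.internal.chooseDecomposition
  exact ⟨_, DirectSum.sum_support_decompose M.gr m⟩

theorem induction (M : DGModule 𝒜) {P : M.carrier → Prop} (h0 : P 0)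
    (hom : ∀ i, ∀ m ∈ M.gr i, P m) (add : ∀ a b, P a → P b → P (a + b)) (m : M.carrier) : P m :=
  letI := M.internal.chooseDecomposition
  DirectSum.Decomposition.inductionOn M.gr h0 (fun m => hom _ m m.2) add m

/-- Every right `A`-module is a right `A^0`-module by restriction. -/
instance (M : DGModule 𝒜) : Module 𝒜.A0ᵐᵒᵖ M.carrier :=
  Module.compHom M.carrier (RingHom.op 𝒜.A0incl)

theorem A0_smul_def (M : DGModule 𝒜) (r : 𝒜.A0ᵐᵒᵖ) (m : M.carrier) :
    r • m = MulOpposite.op (𝒜.A0incl r.unop) • m := rfl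

/-- `M^i = 0` for `i ≪ 0`. -/
def IsBoundedBelow (M : DGModule 𝒜) : Prop := ∃ n : ℤ, ∀ i < n, M.gr i = ⊥

/-! ### Basic constructions -/

/-- `𝒜` as a dg module over itself. -/
def regular (𝒜 : DGAlgebra k A) : DGModule 𝒜 where
  carrier := A
  gr i := (𝒜.gr i).toAddSubgroup
  internal := isInternal_of_proj _ 𝒜.proj (fun _ _ h => 𝒜.proj_same h)
    (fun _ _ hij _ h => 𝒜.proj_ne hij h)
    (𝒜.induction (zero_mem _)
      (fun i m hm => AddSubgroup.mem_iSup_of_mem (S := fun i => (𝒜.gr i).toAddSubgroup) i hm)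
      (fun _ _ => add_mem))
  smul_mem i j m a hm ha :=
    (SetLike.mul_mem_graded (A := 𝒜.gr) hm ha : m * a ∈ 𝒜.gr (i + j))
  d := 𝒜.d.toAddMonoidHom
  d_mem := 𝒜.d_mem
  d_d := 𝒜.d_d
  leibniz := 𝒜.leibniz

/-- The shift `{n}M`, with `({n}M)^i = M^{i+n}` and differential `(-1)^n d`. -/
def shift (n : ℤ) (M : DGModule 𝒜) : DGModule 𝒜 where
  carrier := M.carrier
  gr i := M.gr (i + n)
  internal := isInternal_of_proj _ (fun i => M.proj (i + n)) (fun _ _ h => M.proj_same h)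
    (fun _ _ hij _ h => M.proj_ne (by omega) h)
    (M.induction (zero_mem _)
      (fun i m hm => AddSubgroup.mem_iSup_of_mem (S := fun i => M.gr (i + n)) (i - n)
        (by simpa using hm))
      (fun _ _ => add_mem))
  smul_mem i j m a hm ha := by
    have := M.smul_mem _ _ m a hm ha
    rwa [show i + n + j = i + j + n by ring] at this
  d := n.negOnePow • M.d
  d_mem i m hm := by
    have := M.d_mem _ m hm
    rw [show i + n + 1 = i + 1 + n by ring] at this
    rcases Int.units_eq_one_or n.negOnePow with h | h <;> simpa [h] using this
  d_d m := by
    rcases Int.units_eq_one_or n.negOnePow with h | h <;> simp [h, M.d_d]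
  leibniz i m a hm := by
    have := M.leibniz _ m a hm
    rw [Int.negOnePow_add] at this
    rcases Int.units_eq_one_or n.negOnePow with h | h <;> simp [h, this] <;> abel

/-- The direct sum `M ⊕ N`. -/
def prod (M N : DGModule 𝒜) : DGModule 𝒜 where
  carrier := M.carrier × N.carrier
  gr i := (M.gr i).prod (N.gr i)
  internal := isInternal_of_proj _ (fun i => (M.proj i).prodMap (N.proj i))
    (fun _ _ h => Prod.ext (M.proj_same h.1) (N.proj_same h.2))
    (fun _ _ hij _ h => Prod.ext (M.proj_ne hij h.1) (N.proj_ne hij h.2))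
    (fun x => by
      have h1 : ∀ m : M.carrier, (m, (0 : N.carrier)) ∈ ⨆ i, (M.gr i).prod (N.gr i) :=
        M.induction (zero_mem _)
          (fun i m hm => AddSubgroup.mem_iSup_of_mem (S := fun i => (M.gr i).prod (N.gr i)) i
            ⟨hm, zero_mem _⟩)
          (fun a b ha hb => by simpa using add_mem ha hb)
      have h2 : ∀ n : N.carrier, ((0 : M.carrier), n) ∈ ⨆ i, (M.gr i).prod (N.gr i) :=
        N.induction (zero_mem _)
          (fun i m hm => AddSubgroup.mem_iSup_of_mem (S := fun i => (M.gr i).prod (N.gr i)) i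
            ⟨zero_mem _, hm⟩)
          (fun a b ha hb => by simpa using add_mem ha hb)
      simpa using add_mem (h1 x.1) (h2 x.2))
  smul_mem i j x a hx ha := ⟨M.smul_mem i j _ a hx.1 ha, N.smul_mem i j _ a hx.2 ha⟩
  d := M.d.prodMap N.d
  d_mem i x hx := ⟨M.d_mem i _ hx.1, N.d_mem i _ hx.2⟩
  d_d x := Prod.ext (M.d_d _) (N.d_d _)
  leibniz i x a hx := Prod.ext (M.leibniz i _ a hx.1) (N.leibniz i _ a hx.2)

/-! ### Morphisms, homotopies and cones -/

/-- A morphism in `dgMod(𝒜)`: an `A`-linear map of degree zero which commutes with the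
differentials. -/
structure Hom (M N : DGModule 𝒜) where
  toLin : M.carrier →ₗ[Aᵐᵒᵖ] N.carrier
  map_mem : ∀ (i : ℤ) (m : M.carrier), m ∈ M.gr i → toLin m ∈ N.gr i
  map_d : ∀ m : M.carrier, toLin (M.d m) = N.d (toLin m)

/-- The identity morphism. -/
def Hom.id (M : DGModule 𝒜) : Hom M M := ⟨LinearMap.id, fun _ _ h => h, fun _ => rfl⟩

/-- `g.comp f` is the composition `M → N → P` of `f` and `g`. -/
def Hom.comp {M N P : DGModule 𝒜} (g : Hom N P) (f : Hom M N) : Hom M P :=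
  ⟨g.toLin.comp f.toLin, fun i m hm => g.map_mem i _ (f.map_mem i m hm), fun m => by
    simp [f.map_d, g.map_d]⟩

/-- `f` is an isomorphism in `dgMod(𝒜)`. -/
def Hom.IsIso {M N : DGModule 𝒜} (f : Hom M N) : Prop :=
  ∃ g : Hom N M, g.comp f = Hom.id M ∧ f.comp g = Hom.id N

/-- `M` and `N` are isomorphic in `dgMod(𝒜)`. -/
def Iso (M N : DGModule 𝒜) : Prop := ∃ f : Hom M N, f.IsIso

/-- `f` and `g` are homotopic: `f - g = d h + h d` for an `A`-linear map `h` of degree `-1`.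
Morphisms in `dgHot(𝒜)` are the homotopy classes of morphisms in `dgMod(𝒜)`. -/
def Homotopic {M N : DGModule 𝒜} (f g : Hom M N) : Prop :=
  ∃ h : M.carrier →ₗ[Aᵐᵒᵖ] N.carrier,
    (∀ (i : ℤ) (m : M.carrier), m ∈ M.gr i → h m ∈ N.gr (i - 1)) ∧
    ∀ m : M.carrier, f.toLin m - g.toLin m = N.d (h m) + h (M.d m)

/-- `f` is a homotopy equivalence, i.e. it becomes an isomorphism in `dgHot(𝒜)`. -/
def Hom.IsHomotopyEquiv {M N : DGModule 𝒜} (f : Hom M N) : Prop :=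
  ∃ g : Hom N M, Homotopic (g.comp f) (Hom.id M) ∧ Homotopic (f.comp g) (Hom.id N)

/-- `M` and `N` are isomorphic in `dgHot(𝒜)`. -/
def HotIso (M N : DGModule 𝒜) : Prop := ∃ f : Hom M N, f.IsHomotopyEquiv

/-- The mapping cone `N ⊕ {1}M` of `f : M → N`, with differential
`(n, m) ↦ (d n + f m, - d m)`. -/
def cone {M N : DGModule 𝒜} (f : Hom M N) : DGModule 𝒜 :=
  let S := prod N (shift 1 M)
  { carrier := N.carrier × M.carrier
    gr := S.gr
    internal := S.internal
    smul_mem := S.smul_mem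
    d :=
      { toFun := fun x => (N.d x.1 + f.toLin x.2, - M.d x.2)
        map_zero' := by simp
        map_add' := fun x y => by
          refine Prod.ext ?_ ?_ <;> simp <;> abel }
    d_mem := fun i x hx => ⟨add_mem (N.d_mem i _ hx.1) (f.map_mem _ _ hx.2),
      (M.gr (i + 1 + 1)).neg_mem (M.d_mem _ _ hx.2)⟩
    d_d := fun x => by
      refine Prod.ext ?_ ?_ <;> simp [N.d_d, M.d_d, f.map_d]
    leibniz := fun i x a hx => by
      have h1 := N.leibniz i x.1 a hx.1
      have h2 := M.leibniz (i + 1) x.2 a hx.2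
      rw [Int.negOnePow_succ] at h2
      refine Prod.ext ?_ ?_
      · simp [h1]; abel
      · simp [h2, Units.neg_smul]; abel }

/-- `dgPer(𝒜)` (inside `dgHot(𝒜)`): the smallest class of dg modules which contains `𝒜`, is closed
under isomorphisms in `dgHot(𝒜)`, under all shifts and under cones of morphisms (so that it is the
class of objects of a strict full triangulated subcategory of `dgHot(𝒜)`), and is closed under
direct summands in `dgHot(𝒜)`. -/
inductive IsPerfect : DGModule 𝒜 → Prop
  | regular : IsPerfect (DGModule.regular 𝒜)
  | iso {M N : DGModule 𝒜} : IsPerfect M → HotIso M N → IsPerfect N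
  | shift (n : ℤ) {M : DGModule 𝒜} : IsPerfect M → IsPerfect (DGModule.shift n M)
  | cone {M N : DGModule 𝒜} (f : Hom M N) :
      IsPerfect M → IsPerfect N → IsPerfect (DGModule.cone f)
  | summand {M N : DGModule 𝒜} : IsPerfect (DGModule.prod M N) → IsPerfect M

/-- `M` is homotopically minimal: every endomorphism in `dgMod(𝒜)` which is a homotopy equivalence
is an isomorphism. -/
def IsHomotopicallyMinimal (M : DGModule 𝒜) : Prop :=
  ∀ f : Hom M M, f.IsHomotopyEquiv → f.IsIso

/-! ### Dg submodules and quotients -/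

/-- A dg submodule: an `A`-submodule which is graded and stable under the differential. -/
structure DGSub (M : DGModule 𝒜) where
  toSubmodule : Submodule Aᵐᵒᵖ M.carrier
  proj_mem : ∀ (i : ℤ), ∀ m ∈ toSubmodule, M.proj i m ∈ toSubmodule
  d_mem : ∀ m ∈ toSubmodule, M.d m ∈ toSubmodule

/-- A dg submodule as a dg module. -/
def DGSub.toDGModule {M : DGModule 𝒜} (S : DGSub M) : DGModule 𝒜 where
  carrier := S.toSubmodule
  gr i := (M.gr i).comap S.toSubmodule.subtype.toAddMonoidHom
  internal := isInternal_of_proj _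
    (fun i => ((M.proj i).comp S.toSubmodule.subtype.toAddMonoidHom).codRestrict
      S.toSubmodule (fun x => S.proj_mem i _ x.2))
    (fun _ _ h => Subtype.ext (M.proj_same h))
    (fun _ _ hij _ h => Subtype.ext (M.proj_ne hij h))
    (fun x => by
      obtain ⟨s, hs⟩ := M.exists_sum_proj x.1
      have : x = ∑ i ∈ s, (⟨M.proj i x.1, S.proj_mem i _ x.2⟩ : S.toSubmodule) := by
        apply Subtype.ext
        simp [hs]
      rw [this]
      exact sum_mem fun i _ => AddSubgroup.mem_iSup_of_mem
        (S := fun i => (M.gr i).comap S.toSubmodule.subtype.toAddMonoidHom) i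
        (M.proj_mem i x.1))
  smul_mem i j m a hm ha := M.smul_mem i j m.1 a hm ha
  d := (M.d.comp S.toSubmodule.subtype.toAddMonoidHom).codRestrict
      S.toSubmodule (fun x => S.d_mem _ x.2)
  d_mem i m hm := M.d_mem i m.1 hm
  d_d m := Subtype.ext (M.d_d m.1)
  leibniz i m a hm := Subtype.ext (by
    have := M.leibniz i m.1 a hm
    rcases Int.units_eq_one_or i.negOnePow with h | h <;> simpa [h] using this)

/-- An additive endomorphism of `X` which preserves the submodule `S` acts on `X ⧸ S`. -/
def quotMap {R X : Type*} [Ring R] [AddCommGroup X] [Module R X] (S : Submodule R X)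
    (p : X →+ X) (hp : ∀ x ∈ S, p x ∈ S) : (X ⧸ S) →+ (X ⧸ S) :=
  QuotientAddGroup.map S.toAddSubgroup S.toAddSubgroup p hp

theorem quotMap_mk {R X : Type*} [Ring R] [AddCommGroup X] [Module R X] (S : Submodule R X)
    (p : X →+ X) (hp : ∀ x ∈ S, p x ∈ S) (x : X) :
    quotMap S p hp (S.mkQ x) = S.mkQ (p x) := rfl

/-- The quotient of a dg module by a dg submodule. -/
def quot (M : DGModule 𝒜) (S : DGSub M) : DGModule 𝒜 where
  carrier := M.carrier ⧸ S.toSubmodule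
  gr i := (M.gr i).map S.toSubmodule.mkQ.toAddMonoidHom
  internal := isInternal_of_proj _
    (fun i => quotMap S.toSubmodule (M.proj i) (S.proj_mem i))
    (by
      rintro i _ ⟨x, hx, rfl⟩
      exact congrArg S.toSubmodule.mkQ (M.proj_same hx))
    (by
      rintro i j hij _ ⟨x, hx, rfl⟩
      exact (congrArg S.toSubmodule.mkQ (M.proj_ne hij hx)).trans (map_zero _))
    (fun x => by
      obtain ⟨m, rfl⟩ := S.toSubmodule.mkQ_surjective x
      refine M.induction (P := fun m => S.toSubmodule.mkQ m ∈
        ⨆ i, (M.gr i).map S.toSubmodule.mkQ.toAddMonoidHom) ?_ ?_ ?_ m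
      · rw [map_zero]; exact zero_mem _
      · exact fun i m hm => AddSubgroup.mem_iSup_of_mem
          (S := fun i => (M.gr i).map S.toSubmodule.mkQ.toAddMonoidHom) i ⟨m, hm, rfl⟩
      · intro a b ha hb
        rw [map_add]
        exact add_mem ha hb)
  smul_mem := by
    rintro i j _ a ⟨m, hm, rfl⟩ ha
    exact ⟨_, M.smul_mem i j m a hm ha, rfl⟩
  d := quotMap S.toSubmodule M.d S.d_mem
  d_mem := by
    rintro i _ ⟨m, hm, rfl⟩
    exact ⟨_, M.d_mem i m hm, rfl⟩
  d_d x := by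
    obtain ⟨m, rfl⟩ := S.toSubmodule.mkQ_surjective x
    rw [quotMap_mk, quotMap_mk, M.d_d, map_zero]
  leibniz := by
    rintro i _ a ⟨m, hm, rfl⟩
    have := congrArg S.toSubmodule.mkQ (M.leibniz i m a hm)
    rcases Int.units_eq_one_or i.negOnePow with h | h
    · simp only [h, one_smul, map_add] at this ⊢
      exact this
    · simp only [h, Units.neg_smul, one_smul, map_add, map_neg] at this ⊢
      exact this

/-- For dg submodules `F` and `G` of `M`, the subquotient `G / (F ∩ G)` (which is `G / F` if
`F ⊆ G`). -/
def subquot {M : DGModule 𝒜} (F G : DGSub M) : DGModule 𝒜 :=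
  G.toDGModule.quot
    { toSubmodule := F.toSubmodule.comap G.toSubmodule.subtype
      proj_mem := fun i m hm => by
        have key : G.toSubmodule.subtype (G.toDGModule.proj i m) =
            M.proj i (G.toSubmodule.subtype m) := by
          refine G.toDGModule.induction (P := fun m =>
            G.toSubmodule.subtype (G.toDGModule.proj i m) =
              M.proj i (G.toSubmodule.subtype m)) ?_ ?_ ?_ m
          · rw [map_zero]; exact (map_zero (M.proj i)).symm
          · intro j m hm
            by_cases hij : j = i
            · subst hij
              rw [proj_same _ hm]; exact (M.proj_same hm).symm
            · rw [proj_ne _ hij hm]; exact (M.proj_ne hij hm).symm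
          · intro a b ha hb
            rw [map_add]
            exact (congrArg₂ (· + ·) ha hb).trans (map_add (M.proj i) a.1 b.1).symm
        show G.toSubmodule.subtype (G.toDGModule.proj i m) ∈ F.toSubmodule
        rw [key]
        exact F.proj_mem i _ hm
      d_mem := fun m hm => F.d_mem m.1 hm }

/-- The dg submodule generated by a set of homogeneous elements whose differentials lie in the
submodule that it spans. -/
def DGSub.span (M : DGModule 𝒜) (S : Set M.carrier) (hS : ∀ s ∈ S, ∃ i, s ∈ M.gr i)
    (hd : ∀ s ∈ S, M.d s ∈ Submodule.span Aᵐᵒᵖ S) : DGSub M where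
  toSubmodule := Submodule.span Aᵐᵒᵖ S
  proj_mem i m hm := by
    induction hm using Submodule.closure_induction with
    | zero => rw [map_zero]; exact zero_mem _
    | add x y _ _ hx hy => rw [map_add]; exact add_mem hx hy
    | smul_mem r s hs =>
      obtain ⟨j, hj⟩ := hS s hs
      refine 𝒜.induction (P := fun a => M.proj i (MulOpposite.op a • s) ∈
        Submodule.span Aᵐᵒᵖ S) ?_ ?_ ?_ r.unop
      · simp
      · intro l a ha
        have h1 := M.smul_mem j l s a hj ha
        by_cases hi : j + l = i
        · subst hi
          rw [M.proj_same h1]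
          exact Submodule.smul_mem _ _ (Submodule.subset_span hs)
        · rw [M.proj_ne hi h1]; exact zero_mem _
      · intro a b ha hb
        rw [MulOpposite.op_add, add_smul, map_add]
        exact add_mem ha hb
  d_mem m hm := by
    induction hm using Submodule.closure_induction with
    | zero => rw [map_zero]; exact zero_mem _
    | add x y _ _ hx hy => rw [map_add]; exact add_mem hx hy
    | smul_mem r s hs =>
      obtain ⟨j, hj⟩ := hS s hs
      have h := M.leibniz j s r.unop hj
      rw [MulOpposite.op_unop] at h
      rw [h]
      have h1 : MulOpposite.op (𝒜.d r.unop) • s ∈ Submodule.span Aᵐᵒᵖ S :=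
        Submodule.smul_mem _ _ (Submodule.subset_span hs)
      refine add_mem (Submodule.smul_mem _ _ (hd s hs)) ?_
      rcases Int.units_eq_one_or j.negOnePow with h2 | h2
      · rw [h2, one_smul]; exact h1
      · rw [h2, Units.neg_smul, one_smul]; exact neg_mem h1

/-! ### The reduction `M / M A^+`, its cohomology and lengths -/

/-- The graded submodule `M_{≤ i} = ∑_{j ≤ i} M^j A` generated by the parts of degree `≤ i`. -/
def le (M : DGModule 𝒜) (i : ℤ) : Submodule Aᵐᵒᵖ M.carrier :=
  Submodule.span Aᵐᵒᵖ {m | ∃ j ≤ i, m ∈ M.gr j}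

/-- The dg submodule `M A^+`, where `A^+ = ⨁_{j > 0} A^j`. It is generated by the products `m a`
with `m` homogeneous and `a` homogeneous of positive degree. -/
def mulAPlus (M : DGModule 𝒜) : DGSub M :=
  DGSub.span M {x | ∃ (i j : ℤ) (m : M.carrier) (a : A),
      m ∈ M.gr i ∧ 0 < j ∧ a ∈ 𝒜.gr j ∧ x = MulOpposite.op a • m}
    (by
      rintro _ ⟨i, j, m, a, hm, _, ha, rfl⟩
      exact ⟨_, M.smul_mem i j m a hm ha⟩)
    (by
      rintro _ ⟨i, j, m, a, hm, hj, ha, rfl⟩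
      rw [M.leibniz i m a hm]
      refine add_mem (Submodule.subset_span ⟨i + 1, j, _, a, M.d_mem i m hm, hj, ha, rfl⟩) ?_
      have h1 : MulOpposite.op (𝒜.d a) • m ∈ Submodule.span Aᵐᵒᵖ {x | ∃ (i j : ℤ)
          (m : M.carrier) (a : A), m ∈ M.gr i ∧ 0 < j ∧ a ∈ 𝒜.gr j ∧
            x = MulOpposite.op a • m} :=
        Submodule.subset_span ⟨i, j + 1, m, _, hm, by omega, 𝒜.d_mem j a ha, rfl⟩
      rcases Int.units_eq_one_or i.negOnePow with h2 | h2
      · rw [h2, one_smul]; exact h1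
      · rw [h2, Units.neg_smul, one_smul]; exact neg_mem h1)

/-- The dg module `M̄ = M / M A^+ = M ⊗_A A^0` (with `A^0 = A / A^+`). -/
def bar (M : DGModule 𝒜) : DGModule 𝒜 := M.quot M.mulAPlus

/-- The differential of `M̄` as a map of right `A^0`-modules. -/
def barD (M : DGModule 𝒜) : M.bar.carrier →ₗ[𝒜.A0ᵐᵒᵖ] M.bar.carrier where
  toFun := M.bar.d
  map_add' := map_add _
  map_smul' r x := by
    refine M.bar.induction (P := fun x => M.bar.d (r • x) = r • M.bar.d x) ?_ ?_ ?_ x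
    · simp
    · rintro i _ ⟨m, hm, rfl⟩
      have h := M.bar.leibniz i (M.mulAPlus.toSubmodule.mkQ m) (𝒜.A0incl r.unop) ⟨m, hm, rfl⟩
      have h0 : MulOpposite.op (𝒜.d (𝒜.A0incl r.unop)) •
          (show M.bar.carrier from M.mulAPlus.toSubmodule.mkQ m) = 0 := by
        refine (Submodule.Quotient.mk_eq_zero M.mulAPlus.toSubmodule).2 (Submodule.subset_span ?_)
        exact ⟨i, 0 + 1, m, _, hm, by omega, 𝒜.d_mem 0 _ (𝒜.A0incl_mem _), rfl⟩
      rw [h0, smul_zero, add_zero] at h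
      exact h
    · intro a b ha hb
      rw [smul_add, map_add, ha, hb, map_add, smul_add]

/-- The cohomology `H(M̄) = ker d / im d`, a right `A^0`-module. -/
abbrev barH (M : DGModule 𝒜) : Type u :=
  LinearMap.ker M.barD ⧸ (LinearMap.range M.barD).submoduleOf (LinearMap.ker M.barD)

/-- The length `λ(M̄)` of the right `A^0`-module `M̄`, in `ℕ ∪ {∞}`. -/
def barLength (M : DGModule 𝒜) : ℕ∞ := Module.length 𝒜.A0ᵐᵒᵖ M.bar.carrier

/-- The length `λ(H(M̄))` of the right `A^0`-module `H(M̄)`, in `ℕ ∪ {∞}`. -/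
def barHLength (M : DGModule 𝒜) : ℕ∞ := Module.length 𝒜.A0ᵐᵒᵖ M.barH

/-! ### The modules `L ⊗_{A^0} A` and the category `dgFilt` -/

/-- The dg module `L ⊗_ℤ A` for an abelian group `L` in degree zero, written as `A ⊗_ℤ L` with `A`
acting from the right on the factor `A`; the differential is `a ⊗ l ↦ d a ⊗ l`. -/
def tensorInt (𝒜 : DGAlgebra k A) (L : Type u) [AddCommGroup L] : DGModule 𝒜 where
  carrier := A ⊗[ℤ] L
  gr i := AddSubgroup.closure {x | ∃ a ∈ 𝒜.gr i, ∃ l : L, x = a ⊗ₜ[ℤ] l}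
  internal := isInternal_of_proj _
    (fun i => (LinearMap.rTensor L (𝒜.proj i).toIntLinearMap).toAddMonoidHom)
    (fun i x hx => by
      induction hx using AddSubgroup.closure_induction with
      | mem x hx =>
        obtain ⟨a, ha, l, rfl⟩ := hx
        simp [𝒜.proj_same ha]
      | zero => simp
      | add x y _ _ hx hy => rw [map_add, hx, hy]
      | neg x _ hx => rw [map_neg, hx])
    (fun i j hij x hx => by
      induction hx using AddSubgroup.closure_induction with
      | mem x hx =>
        obtain ⟨a, ha, l, rfl⟩ := hx
        simp [𝒜.proj_ne hij ha]
      | zero => simp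
      | add x y _ _ hx hy => rw [map_add, hx, hy, add_zero]
      | neg x _ hx => rw [map_neg, hx, neg_zero])
    (fun x => by
      induction x using TensorProduct.induction_on with
      | zero => exact zero_mem _
      | add x y hx hy => exact add_mem hx hy
      | tmul a l =>
        refine 𝒜.induction (P := fun a => a ⊗ₜ[ℤ] l ∈ ⨆ i, AddSubgroup.closure
          {x | ∃ a ∈ 𝒜.gr i, ∃ l : L, x = a ⊗ₜ[ℤ] l}) ?_ ?_ ?_ a
        · rw [TensorProduct.zero_tmul]; exact zero_mem _
        · exact fun i a ha => AddSubgroup.mem_iSup_of_mem (S := fun i => AddSubgroup.closure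
            {x | ∃ a ∈ 𝒜.gr i, ∃ l : L, x = a ⊗ₜ[ℤ] l}) i
            (AddSubgroup.subset_closure ⟨a, ha, l, rfl⟩)
        · intro a b ha hb
          rw [TensorProduct.add_tmul]
          exact add_mem ha hb)
  smul_mem i j x b hx hb := by
    induction hx using AddSubgroup.closure_induction with
    | mem x hx =>
      obtain ⟨a, ha, l, rfl⟩ := hx
      exact AddSubgroup.subset_closure ⟨a * b, SetLike.mul_mem_graded ha hb, l, rfl⟩
    | zero => rw [smul_zero]; exact zero_mem _
    | add x y _ _ hx hy => rw [smul_add]; exact add_mem hx hy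
    | neg x _ hx => rw [smul_neg]; exact neg_mem hx
  d := (LinearMap.rTensor L (𝒜.d.toAddMonoidHom.toIntLinearMap)).toAddMonoidHom
  d_mem i x hx := by
    induction hx using AddSubgroup.closure_induction with
    | mem x hx =>
      obtain ⟨a, ha, l, rfl⟩ := hx
      exact AddSubgroup.subset_closure ⟨𝒜.d a, 𝒜.d_mem i a ha, l, rfl⟩
    | zero => rw [map_zero]; exact zero_mem _
    | add x y _ _ hx hy => rw [map_add]; exact add_mem hx hy
    | neg x _ hx => rw [map_neg]; exact neg_mem hx
  d_d x := by
    induction x using TensorProduct.induction_on with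
    | zero => simp
    | add x y hx hy => rw [map_add, map_add, hx, hy, add_zero]
    | tmul a l => simp [𝒜.d_d]
  leibniz i x b hx := by
    induction hx using AddSubgroup.closure_induction with
    | mem x hx =>
      obtain ⟨a, ha, l, rfl⟩ := hx
      have h := congrArg (fun c => c ⊗ₜ[ℤ] l) (𝒜.leibniz i a b ha)
      rcases Int.units_eq_one_or i.negOnePow with h2 | h2
      · simp only [h2, one_smul, TensorProduct.add_tmul] at h ⊢
        exact h
      · simp only [h2, Units.neg_smul, one_smul, TensorProduct.add_tmul,
          TensorProduct.neg_tmul] at h ⊢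
        exact h
    | zero => simp
    | add x y _ _ hx hy =>
      simp only [smul_add, map_add, hx, hy]
      abel
    | neg x _ hx =>
      simp only [smul_neg, map_neg, hx]
      abel

/-- If `d(A^0) = 0`: the dg module `L̂ = L ⊗_{A^0} A` for a right `A^0`-module `L` in degree zero,
i.e. the quotient of `L ⊗_ℤ A` by the relations `l r ⊗ a = l ⊗ r a` for `r ∈ A^0`. -/
def hat {𝒜 : DGAlgebra k A} (h0 : ∀ a ∈ 𝒜.gr 0, 𝒜.d a = 0) (L : Type u) [AddCommGroup L]
    [Module 𝒜.A0ᵐᵒᵖ L] : DGModule 𝒜 :=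
  (tensorInt 𝒜 L).quot (DGSub.span (tensorInt 𝒜 L)
    {x | ∃ (j : ℤ) (a : A) (r : 𝒜.A0) (l : L), a ∈ 𝒜.gr j ∧
      x = (𝒜.A0incl r * a) ⊗ₜ[ℤ] l - a ⊗ₜ[ℤ] (MulOpposite.op r • l)}
    (by
      rintro _ ⟨j, a, r, l, ha, rfl⟩
      refine ⟨j, sub_mem (AddSubgroup.subset_closure ⟨_, ?_, l, rfl⟩)
        (AddSubgroup.subset_closure ⟨a, ha, _, rfl⟩)⟩
      simpa using SetLike.mul_mem_graded (𝒜.A0incl_mem r) ha)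
    (by
      rintro _ ⟨j, a, r, l, ha, rfl⟩
      refine Submodule.subset_span ⟨j + 1, 𝒜.d a, r, l, 𝒜.d_mem j a ha, ?_⟩
      have h : 𝒜.d (𝒜.A0incl r * a) = 𝒜.A0incl r * 𝒜.d a := by
        rw [𝒜.leibniz 0 _ a (𝒜.A0incl_mem r), h0 _ (𝒜.A0incl_mem r)]; simp
      rw [← h]
      exact map_sub (tensorInt 𝒜 L).d _ _))

/-- `M` is in `dgFilt(𝒜)`: there is a finite filtration `0 = F_0 ⊆ F_1 ⊆ ... ⊆ F_n = M` by dg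
submodules with subquotients `F_i / F_{i-1} ≅ {l_i} L̂_i` in `dgMod(𝒜)` for simple right
`A^0`-modules `L_i` and integers `l_1 ≥ l_2 ≥ ... ≥ l_n`. -/
def IsFilt (h0 : ∀ a ∈ 𝒜.gr 0, 𝒜.d a = 0) (M : DGModule 𝒜) : Prop :=
  ∃ (n : ℕ) (F : Fin (n + 1) → DGSub M) (l : Fin n → ℤ),
    (F 0).toSubmodule = ⊥ ∧ (F (Fin.last n)).toSubmodule = ⊤ ∧ Antitone l ∧
    ∀ i : Fin n, (F i.castSucc).toSubmodule ≤ (F i.succ).toSubmodule ∧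
      ∃ (L : Type u) (_ : AddCommGroup L) (_ : Module 𝒜.A0ᵐᵒᵖ L),
        IsSimpleModule 𝒜.A0ᵐᵒᵖ L ∧
        Iso (subquot (F i.castSucc) (F i.succ)) (shift (l i) (hat h0 L))

end DGModule

end

/-! ### Linear algebra: quasi-inverses, nilpotence, lifting of idempotents. -/

section LinearAlgebra

/-- Over a semisimple ring every linear map is von Neumann regular. -/
theorem LinearMap.exists_comp_comp_eq_self {R X Y : Type*} [Ring R] [IsSemisimpleRing R]
    [AddCommGroup X] [Module R X] [AddCommGroup Y] [Module R Y] (φ : X →ₗ[R] Y) :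
    ∃ ψ : Y →ₗ[R] X, ∀ x, φ (ψ (φ x)) = φ x := by
  obtain ⟨h, hh⟩ := IsSemisimpleModule.lifting_property φ.rangeRestrict
    φ.surjective_rangeRestrict LinearMap.id
  obtain ⟨ψ, hψ⟩ := IsSemisimpleModule.extension_property (LinearMap.range φ).subtype
    Subtype.val_injective h
  refine ⟨ψ, fun x => ?_⟩
  have h1 := LinearMap.congr_fun hψ (φ.rangeRestrict x)
  have h2 := LinearMap.congr_fun hh (φ.rangeRestrict x)
  exact (congrArg φ h1).trans (congrArg Subtype.val h2)

/-- A locally nilpotent endomorphism of a finite module is nilpotent. -/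
theorem LinearMap.exists_pow_eq_zero_of_finite {R X : Type*} [Ring R] [AddCommGroup X]
    [Module R X] [Module.Finite R X] (ν : Module.End R X) (h : ∀ x, ∃ n : ℕ, (ν ^ n) x = 0) :
    ∃ n : ℕ, ν ^ n = 0 := by
  obtain ⟨S, hS⟩ := Module.Finite.fg_top (R := R) (M := X)
  choose g hg using h
  refine ⟨Finset.sup S g, LinearMap.ext fun m => ?_⟩
  have hm : m ∈ Submodule.span R (S : Set X) := by simp [hS]
  induction hm using Submodule.span_induction with
  | mem x hx => exact Module.End.pow_map_zero_of_le (Finset.le_sup hx) (hg x)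
  | zero => simp
  | add => simp_all
  | smul => simp_all

/-- On each vector the geometric series in `1 - φ` is a finite sum and provides a preimage; a kernel
vector of `φ` is fixed by `1 - φ`, hence zero. -/
theorem LinearMap.bijective_of_locally_nilpotent {R X : Type*} [Ring R] [AddCommGroup X]
    [Module R X] (φ : Module.End R X) (h : ∀ x, ∃ n : ℕ, ((1 - φ) ^ n) x = 0) :
    Function.Bijective φ := by
  constructor
  · refine (injective_iff_map_eq_zero φ).2 fun x hx => ?_
    obtain ⟨n, hn⟩ := h x
    have key : ∀ n : ℕ, ((1 - φ) ^ n) x = x := by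
      intro n
      induction n with
      | zero => simp
      | succ n ih => rw [pow_succ, Module.End.mul_apply]; simp [hx, ih]
    rw [key] at hn
    exact hn
  · intro y
    obtain ⟨n, hn⟩ := h y
    refine ⟨(∑ i ∈ Finset.range n, (1 - φ) ^ i) y, ?_⟩
    have := LinearMap.congr_fun (mul_neg_geom_sum (1 - φ) n) y
    simpa [hn] using this

open Polynomial in
/-- Integral polynomials lifting idempotents along an ideal with `n`-th power zero. -/
theorem exists_idempotent_polynomial (n : ℕ) :
    ∃ p q r : ℤ[X], p * p - p = (X ^ 2 - X) ^ n * r ∧ p - X = q * (X ^ 2 - X) := by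
  rcases Nat.eq_zero_or_pos n with rfl | hn
  · exact ⟨X, 0, X ^ 2 - X, by ring, by ring⟩
  obtain ⟨m, rfl⟩ : ∃ m, n = m + 1 := ⟨n - 1, by omega⟩
  -- This `p` is divisible by `X ^ n`, and `1 - p` by `(1 - X) ^ n`, so `p (1 - p)` is divisible by
  -- `(X ^ 2 - X) ^ n`. It takes the values 0 at 0 and 1 at 1, whence the factorization of `p - X`.
  set p : ℤ[X] := 1 - (1 - X ^ (m + 1)) ^ (m + 1) with hp
  obtain ⟨a, ha⟩ : (X ^ (m + 1) : ℤ[X]) ∣ p := by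
    have := sub_dvd_pow_sub_pow (1 : ℤ[X]) (1 - X ^ (m + 1)) (m + 1)
    simpa [hp] using this
  obtain ⟨b, hb⟩ : (1 - X : ℤ[X]) ^ (m + 1) ∣ 1 - p := by
    rw [hp, sub_sub_cancel]
    exact pow_dvd_pow_of_dvd (by simpa using sub_dvd_pow_sub_pow (1 : ℤ[X]) X (m + 1)) _
  obtain ⟨q, hq⟩ : (X : ℤ[X]) ∣ p - X :=
    dvd_sub ⟨X ^ m * a, by rw [ha]; ring⟩ dvd_rfl
  have h1 : (X - C 1 : ℤ[X]) ∣ q := by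
    rw [dvd_iff_isRoot, IsRoot.def]
    have h2 := congrArg (eval 1) hq
    have h3 := congrArg (eval 1) hb
    simp only [eval_sub, eval_X, eval_mul, eval_one, eval_pow, sub_self, one_mul] at h2 h3
    rw [zero_pow (Nat.succ_ne_zero m), zero_mul] at h3
    linarith
  obtain ⟨c, hc⟩ := h1
  refine ⟨p, c, (-1) ^ m * a * b, ?_, ?_⟩
  · have e1 : (X ^ 2 - X : ℤ[X]) = (-1) * (X * (1 - X)) := by ring
    have e2 : p * p - p = -(p * (1 - p)) := by ring
    have e3 : ((-1 : ℤ[X]) ^ m) * (-1) ^ m = 1 := by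
      rw [← mul_pow]; simp
    calc p * p - p = -((X ^ (m + 1) * a) * ((1 - X) ^ (m + 1) * b)) := by rw [e2, hb]; nth_rw 1 [ha]
      _ = (((-1 : ℤ[X]) ^ m) * (-1) ^ m) * -((X ^ (m + 1) * a) * ((1 - X) ^ (m + 1) * b)) := by
        rw [e3, one_mul]
      _ = _ := by rw [e1, mul_pow, mul_pow]; ring
  · rw [hq, hc, C_1]; ring

end LinearAlgebra

namespace DGModule

variable {k : Type w} {A : Type u} [CommRing k] [Ring A] [Algebra k A] {𝒜 : DGAlgebra k A}

/-! ### Homogeneous components -/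

theorem eq_zero_of_proj {M : DGModule 𝒜} {x : M.carrier} (h : ∀ i, M.proj i x = 0) : x = 0 := by
  obtain ⟨s, hs⟩ := M.exists_sum_proj x
  rw [← hs, Finset.sum_eq_zero fun i _ => h i]

theorem mem_gr_iff {M : DGModule 𝒜} {i : ℤ} {x : M.carrier} :
    x ∈ M.gr i ↔ M.proj i x = x :=
  ⟨M.proj_same, fun h => h ▸ M.proj_mem i x⟩

theorem map_proj {M N : DGModule 𝒜} (f : M.carrier →+ N.carrier) (n : ℤ)
    (hf : ∀ i, ∀ m ∈ M.gr i, f m ∈ N.gr (i + n)) (i : ℤ) (x : M.carrier) :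
    f (M.proj i x) = N.proj (i + n) (f x) := by
  refine M.induction (P := fun x => f (M.proj i x) = N.proj (i + n) (f x)) ?_ ?_ ?_ x
  · simp
  · intro j m hm
    by_cases hij : j = i
    · subst hij; rw [M.proj_same hm, N.proj_same (hf _ _ hm)]
    · rw [M.proj_ne hij hm, N.proj_ne (by omega) (hf _ _ hm), map_zero]
  · intro a b ha hb
    simp only [map_add, ha, hb]

theorem map_proj_zero {M N : DGModule 𝒜} (f : M.carrier →+ N.carrier)
    (hf : ∀ i, ∀ m ∈ M.gr i, f m ∈ N.gr i) (i : ℤ) (x : M.carrier) :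
    f (M.proj i x) = N.proj i (f x) := by
  have := map_proj f 0 (by simpa using hf) i x
  simpa using this

theorem Hom.map_proj {M N : DGModule 𝒜} (f : Hom M N) (i : ℤ) (x : M.carrier) :
    f.toLin (M.proj i x) = N.proj i (f.toLin x) :=
  map_proj_zero f.toLin.toAddMonoidHom f.map_mem i x

theorem d_proj (M : DGModule 𝒜) (i : ℤ) (x : M.carrier) :
    M.d (M.proj i x) = M.proj (i + 1) (M.d x) :=
  DGModule.map_proj M.d 1 M.d_mem i x

theorem smul_proj (M : DGModule 𝒜) {j : ℤ} {a : A} (ha : a ∈ 𝒜.gr j) (i : ℤ) (x : M.carrier) :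
    MulOpposite.op a • M.proj i x = M.proj (i + j) (MulOpposite.op a • x) :=
  DGModule.map_proj (DistribSMul.toAddMonoidHom M.carrier (MulOpposite.op a)) j
    (fun i m hm => M.smul_mem i j m a hm ha) i x

theorem negOnePow_smul_mem {X S : Type*} [AddCommGroup X] [SetLike S X] [AddSubgroupClass S X]
    (s : S) (n : ℤ) {x : X} (hx : x ∈ s) : n.negOnePow • x ∈ s := by
  rcases Int.units_eq_one_or n.negOnePow with h | h <;> simpa [h] using hx

/-- Every linear map has homogeneous components. -/
theorem exists_component {M N : DGModule 𝒜} (f : M.carrier →ₗ[Aᵐᵒᵖ] N.carrier) (n : ℤ) :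
    ∃ g : M.carrier →ₗ[Aᵐᵒᵖ] N.carrier, (∀ i, ∀ m ∈ M.gr i, g m ∈ N.gr (i + n)) ∧
      ∀ i, ∀ m ∈ M.gr i, g m = N.proj (i + n) (f m) := by
  classical
  let _ := M.internal.chooseDecomposition
  let g : M.carrier →+ N.carrier :=
    (DirectSum.toAddMonoid fun i =>
      ((N.proj (i + n)).comp f.toAddMonoidHom).comp (M.gr i).subtype).comp
      (DirectSum.decomposeAddEquiv M.gr).toAddMonoidHom
  have hg : ∀ i, ∀ m ∈ M.gr i, g m = N.proj (i + n) (f m) := by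
    intro i m hm
    have : g m = DirectSum.toAddMonoid (fun i =>
      ((N.proj (i + n)).comp f.toAddMonoidHom).comp (M.gr i).subtype)
      (DirectSum.decompose M.gr m) := rfl
    rw [this, DirectSum.decompose_of_mem M.gr hm, DirectSum.toAddMonoid_of]
    rfl
  refine ⟨{ g with map_smul' := ?_ }, ?_, hg⟩
  · intro r x
    change g (r • x) = r • g x
    refine M.induction (P := fun x => g (r • x) = r • g x) (by simp) ?_ ?_ x
    · intro i m hm
      refine 𝒜.induction (P := fun a => g (MulOpposite.op a • m) = MulOpposite.op a • g m)
        (by simp) ?_ ?_ r.unop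
      · intro j a ha
        rw [hg _ _ (M.smul_mem i j m a hm ha), hg _ _ hm, N.smul_proj ha, map_smul]
        congr 2
        ring
      · intro a b ha hb
        simp only [MulOpposite.op_add, add_smul, map_add, ha, hb]
    · intro a b ha hb
      simp only [smul_add, map_add, ha, hb]
  · intro i m hm
    change g m ∈ _
    rw [hg i m hm]
    exact N.proj_mem _ _

/-! ### The submodules `Y A^{≥ n}` -/

/-- The submodule `Y A^{≥ n}`, for a submodule `Y` of `M`. -/
def smulGE (M : DGModule 𝒜) (Y : Submodule Aᵐᵒᵖ M.carrier) (n : ℤ) :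
    Submodule Aᵐᵒᵖ M.carrier :=
  Submodule.span Aᵐᵒᵖ {x | ∃ j ≥ n, ∃ a ∈ 𝒜.gr j, ∃ y ∈ Y, x = MulOpposite.op a • y}

theorem smul_mem_smulGE {M : DGModule 𝒜} {Y : Submodule Aᵐᵒᵖ M.carrier} {n j : ℤ} (hj : n ≤ j)
    {a : A} (ha : a ∈ 𝒜.gr j) {y : M.carrier} (hy : y ∈ Y) :
    MulOpposite.op a • y ∈ M.smulGE Y n :=
  Submodule.subset_span ⟨j, hj, a, ha, y, hy, rfl⟩

theorem smulGE_mono {M : DGModule 𝒜} {Y Z : Submodule Aᵐᵒᵖ M.carrier} (h : Y ≤ Z) {m n : ℤ}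
    (hmn : m ≤ n) : M.smulGE Y n ≤ M.smulGE Z m :=
  Submodule.span_le.2 (by
    rintro _ ⟨j, hj, a, ha, y, hy, rfl⟩
    exact smul_mem_smulGE (hmn.trans hj) ha (h hy))

/-- No further scalars are needed: with `A` in degrees `≥ 0`, multiplying a coefficient of degree `≥
n` by a homogeneous element of `A` gives zero or again a coefficient of degree `≥ n`. -/
theorem smulGE_induction (hpos : ∀ i < 0, 𝒜.gr i = ⊥) {M : DGModule 𝒜}
    {Y : Submodule Aᵐᵒᵖ M.carrier} {n : ℤ} {P : M.carrier → Prop} (zero : P 0)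
    (add : ∀ x y, P x → P y → P (x + y))
    (smul : ∀ j ≥ n, ∀ a ∈ 𝒜.gr j, ∀ y ∈ Y, P (MulOpposite.op a • y)) {x : M.carrier}
    (hx : x ∈ M.smulGE Y n) : P x := by
  induction hx using Submodule.closure_induction with
  | zero => exact zero
  | add x y _ _ hx hy => exact add x y hx hy
  | smul_mem r s hs =>
    obtain ⟨j, hj, a, ha, y, hy, rfl⟩ := hs
    refine 𝒜.induction (P := fun c => P (MulOpposite.op c • MulOpposite.op a • y)) ?_ ?_ ?_ r.unop
    · simpa using zero
    · intro i c hc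
      rw [smul_smul, ← MulOpposite.op_mul]
      by_cases hi : i < 0
      · rw [hpos i hi] at hc
        rw [(Submodule.mem_bot k).1 hc, mul_zero, MulOpposite.op_zero, zero_smul]
        exact zero
      · exact smul (j + i) (by omega) _ (SetLike.mul_mem_graded ha hc) y hy
    · intro a b ha hb
      rw [MulOpposite.op_add, add_smul]
      exact add _ _ ha hb

theorem smulGE_top_induction (hpos : ∀ i < 0, 𝒜.gr i = ⊥) {M : DGModule 𝒜} {n : ℤ}
    {P : M.carrier → Prop} (zero : P 0) (add : ∀ x y, P x → P y → P (x + y))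
    (smul : ∀ j ≥ n, ∀ a ∈ 𝒜.gr j, ∀ i, ∀ y ∈ M.gr i, P (MulOpposite.op a • y)) {x : M.carrier}
    (hx : x ∈ M.smulGE ⊤ n) : P x := by
  refine smulGE_induction hpos zero add (fun j hj a ha y _ => ?_) hx
  refine M.induction (P := fun y => P (MulOpposite.op a • y)) (by simpa using zero)
    (fun i y hy => smul j hj a ha i y hy) (fun x y hx hy => ?_) y
  rw [smul_add]
  exact add _ _ hx hy

theorem map_mem_smulGE {M N : DGModule 𝒜} (f : M.carrier →ₗ[Aᵐᵒᵖ] N.carrier)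
    {Y : Submodule Aᵐᵒᵖ M.carrier} {Z : Submodule Aᵐᵒᵖ N.carrier} (h : ∀ y ∈ Y, f y ∈ Z) {n : ℤ}
    {x : M.carrier} (hx : x ∈ M.smulGE Y n) : f x ∈ N.smulGE Z n := by
  have : M.smulGE Y n ≤ (N.smulGE Z n).comap f := by
    refine Submodule.span_le.2 ?_
    rintro _ ⟨j, hj, a, ha, y, hy, rfl⟩
    rw [SetLike.mem_coe, Submodule.mem_comap, map_smul]
    exact smul_mem_smulGE hj ha (h y hy)
  exact this hx

theorem map_mem_smulGE_top {M N : DGModule 𝒜} (f : M.carrier →ₗ[Aᵐᵒᵖ] N.carrier) {n : ℤ}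
    {x : M.carrier} (hx : x ∈ M.smulGE ⊤ n) : f x ∈ N.smulGE ⊤ n :=
  map_mem_smulGE f (fun _ _ => Submodule.mem_top) hx

theorem smulGE_smulGE (hpos : ∀ i < 0, 𝒜.gr i = ⊥) {M : DGModule 𝒜}
    (Y : Submodule Aᵐᵒᵖ M.carrier) (m n : ℤ) :
    M.smulGE (M.smulGE Y m) n ≤ M.smulGE Y (m + n) := by
  refine Submodule.span_le.2 ?_
  rintro _ ⟨j, hj, b, hb, y, hy, rfl⟩
  refine smulGE_induction hpos (P := fun y => MulOpposite.op b • y ∈ M.smulGE Y (m + n)) (by simp)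
    (fun x y hx hy => ?_) (fun i hi a ha y hy => ?_) hy
  · rw [smul_add]; exact add_mem hx hy
  · rw [smul_smul, ← MulOpposite.op_mul]
    exact smul_mem_smulGE (by omega) (SetLike.mul_mem_graded ha hb) hy

theorem proj_mem_smulGE (hpos : ∀ i < 0, 𝒜.gr i = ⊥) {M : DGModule 𝒜} {n : ℤ} (i : ℤ)
    {x : M.carrier} (hx : x ∈ M.smulGE ⊤ n) : M.proj i x ∈ M.smulGE ⊤ n := by
  refine smulGE_induction hpos (P := fun x => M.proj i x ∈ M.smulGE ⊤ n) (by simp)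
    (fun x y hx hy => ?_) (fun j hj a ha y _ => ?_) hx
  · rw [map_add]; exact add_mem hx hy
  · have := M.smul_proj ha (i - j) y
    rw [sub_add_cancel] at this
    rw [← this]
    exact smul_mem_smulGE hj ha Submodule.mem_top

theorem proj_eq_zero_of_lt {M : DGModule 𝒜} {a : ℤ} (ha : ∀ i < a, M.gr i = ⊥) {i : ℤ}
    (hi : i < a) (x : M.carrier) : M.proj i x = 0 := by
  have := M.proj_mem i x
  rwa [ha i hi, AddSubgroup.mem_bot] at this

/-- The source of all Nakayama arguments: multiples by `A^{≥ n}` of elements of degrees `≥ a` live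
in degrees `≥ a + n`. -/
theorem proj_smulGE_eq_zero (hpos : ∀ i < 0, 𝒜.gr i = ⊥) {M : DGModule 𝒜} {a : ℤ}
    (hM : ∀ i < a, M.gr i = ⊥) {n i : ℤ} (hi : i < a + n) {x : M.carrier}
    (hx : x ∈ M.smulGE ⊤ n) : M.proj i x = 0 := by
  refine smulGE_induction hpos (P := fun x => M.proj i x = 0) (by simp)
    (fun x y hx hy => by rw [map_add, hx, hy, add_zero]) (fun j hj c hc y _ => ?_) hx
  have := M.smul_proj hc (i - j) y
  rw [sub_add_cancel] at this
  rw [← this, proj_eq_zero_of_lt hM (by omega), smul_zero]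

theorem mulAPlus_eq (M : DGModule 𝒜) : M.mulAPlus.toSubmodule = M.smulGE ⊤ 1 := by
  refine le_antisymm (Submodule.span_mono ?_) (Submodule.span_le.2 ?_)
  · rintro _ ⟨i, j, m, a, _, hj, ha, rfl⟩
    exact ⟨j, by omega, a, ha, m, Submodule.mem_top, rfl⟩
  · rintro _ ⟨j, hj, a, ha, y, _, rfl⟩
    refine M.induction (P := fun y => MulOpposite.op a • y ∈ M.mulAPlus.toSubmodule) (by simp)
      (fun i y hy => Submodule.subset_span ⟨i, j, y, a, hy, by omega, ha, rfl⟩)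
      (fun x y hx hy => ?_) y
    rw [smul_add]
    exact add_mem hx hy

theorem dA_mem (hpos : ∀ i < 0, 𝒜.gr i = ⊥) {M : DGModule 𝒜} {x : M.carrier} (a : A) {Y}
    (hx : x ∈ Y) : MulOpposite.op (𝒜.d a) • x ∈ M.smulGE Y 1 := by
  refine 𝒜.induction (P := fun a => MulOpposite.op (𝒜.d a) • x ∈ M.smulGE Y 1) (by simp)
    (fun i a ha => ?_) (fun a b ha hb => ?_) a
  · by_cases hi : i < 0
    · rw [hpos i hi] at ha
      simp [(Submodule.mem_bot k).1 ha]
    · exact smul_mem_smulGE (by omega) (𝒜.d_mem i a ha) hx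
  · rw [map_add, MulOpposite.op_add, add_smul]; exact add_mem ha hb

/-- The differential maps `M A^+` to `M A^{≥ 2}` if it maps `M` to `M A^+`. -/
theorem d_mem_smulGE_two (hpos : ∀ i < 0, 𝒜.gr i = ⊥) {M : DGModule 𝒜}
    (hM : ∀ x, M.d x ∈ M.smulGE ⊤ 1) {x : M.carrier} (hx : x ∈ M.smulGE ⊤ 1) :
    M.d x ∈ M.smulGE ⊤ 2 := by
  refine smulGE_top_induction hpos (P := fun x => M.d x ∈ M.smulGE ⊤ 2) (by simp)
    (fun x y hx hy => ?_) (fun j hj a ha i y hy => ?_) hx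
  · rw [map_add]; exact add_mem hx hy
  · rw [M.leibniz i y a hy]
    refine add_mem ?_ (negOnePow_smul_mem _ _ ?_)
    · exact smulGE_smulGE hpos ⊤ 1 1 (smul_mem_smulGE hj ha (hM y))
    · exact smul_mem_smulGE (by omega) (𝒜.d_mem j a ha) Submodule.mem_top

/-! ### Nakayama-type arguments -/

/-- The power `ν ^ n` takes values in `M A^{≥ n}` and preserves degrees, so it kills an element of
fixed degree once `n` is large. -/
theorem exists_pow_apply_eq_zero (hpos : ∀ i < 0, 𝒜.gr i = ⊥) {M : DGModule 𝒜}
    (hM : M.IsBoundedBelow) (ν : Module.End Aᵐᵒᵖ M.carrier)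
    (hdeg : ∀ i, ∀ m ∈ M.gr i, ν m ∈ M.gr i) (hν : ∀ x, ν x ∈ M.smulGE ⊤ 1) (x : M.carrier) :
    ∃ n : ℕ, (ν ^ n) x = 0 := by
  obtain ⟨a, ha⟩ := hM
  have hpow : ∀ n : ℕ, ∀ x, (ν ^ n) x ∈ M.smulGE ⊤ n := by
    intro n
    induction n with
    | zero =>
      intro x
      have : x = MulOpposite.op (1 : A) • x := by simp
      rw [pow_zero, Module.End.one_apply, this]
      exact smul_mem_smulGE (j := 0) (by simp) SetLike.GradedOne.one_mem Submodule.mem_top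
    | succ n ih =>
      intro x
      rw [pow_succ, Module.End.mul_apply]
      have h1 := map_mem_smulGE (ν ^ n) (Z := M.smulGE ⊤ n) (fun y _ => ih y) (hν x)
      simpa using smulGE_smulGE hpos ⊤ _ _ h1
  have hpd : ∀ n : ℕ, ∀ i, ∀ m ∈ M.gr i, (ν ^ n) m ∈ M.gr i := by
    intro n
    induction n with
    | zero => intro i m hm; simpa using hm
    | succ n ih => intro i m hm; rw [pow_succ, Module.End.mul_apply]; exact ih i _ (hdeg i m hm)
  refine M.induction (P := fun x => ∃ n : ℕ, (ν ^ n) x = 0) ⟨0, by simp⟩ ?_ ?_ x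
  · intro i m hm
    refine ⟨(i - a + 1).toNat, ?_⟩
    rw [← M.proj_same (hpd _ i m hm)]
    exact proj_smulGE_eq_zero hpos ha (by omega) (hpow _ m)
  · rintro x y ⟨m, hm⟩ ⟨n, hn⟩
    refine ⟨max m n, ?_⟩
    rw [map_add, Module.End.pow_map_zero_of_le (le_max_left m n) hm,
      Module.End.pow_map_zero_of_le (le_max_right m n) hn, add_zero]

/-- Graded Nakayama lemma: boundedness below replaces finite generation. -/
theorem bijective_of_sub_mem (hpos : ∀ i < 0, 𝒜.gr i = ⊥) {M : DGModule 𝒜}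
    (hM : M.IsBoundedBelow) (φ : Module.End Aᵐᵒᵖ M.carrier)
    (hdeg : ∀ i, ∀ m ∈ M.gr i, φ m ∈ M.gr i) (hφ : ∀ x, φ x - x ∈ M.smulGE ⊤ 1) :
    Function.Bijective φ :=
  LinearMap.bijective_of_locally_nilpotent φ
    (exists_pow_apply_eq_zero hpos hM (1 - φ) (fun i m hm => sub_mem hm (hdeg i m hm))
      fun x => by
        have := neg_mem (hφ x)
        rwa [neg_sub] at this)

theorem Hom.isIso_of_bijective {M N : DGModule 𝒜} (f : Hom M N)
    (hf : Function.Bijective f.toLin) : f.IsIso := by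
  let e := LinearEquiv.ofBijective f.toLin hf
  have he : ∀ x, f.toLin (e.symm x) = x := e.apply_symm_apply
  have he' : ∀ x, e.symm (f.toLin x) = x := e.symm_apply_apply
  refine ⟨⟨e.symm.toLinearMap, fun i m hm => ?_, fun m => ?_⟩, ?_, ?_⟩
  · change e.symm m ∈ _
    rw [mem_gr_iff]
    apply hf.1
    rw [f.map_proj, he, N.proj_same hm]
  · change e.symm (N.d m) = M.d (e.symm m)
    apply hf.1
    rw [f.map_d, he, he]
  · simp only [Hom.comp, Hom.id, Hom.mk.injEq]
    exact LinearMap.ext he'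
  · simp only [Hom.comp, Hom.id, Hom.mk.injEq]
    exact LinearMap.ext he

theorem Hom.IsIso.bijective {M N : DGModule 𝒜} {f : Hom M N} (hf : f.IsIso) :
    Function.Bijective f.toLin := by
  obtain ⟨g, h1, h2⟩ := hf
  refine ⟨Function.LeftInverse.injective (g := g.toLin) fun x => ?_,
    Function.RightInverse.surjective (g := g.toLin) fun x => ?_⟩
  · exact LinearMap.congr_fun (congrArg Hom.toLin h1) x
  · exact LinearMap.congr_fun (congrArg Hom.toLin h2) x

/-- In `d h + h d` both terms lie in `N A^+`, because `h` is `A`-linear and both differentials are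
minimal. -/
theorem Homotopic.sub_mem {M N : DGModule 𝒜} {f g : Hom M N} (h : Homotopic f g)
    (hM : ∀ x, M.d x ∈ M.smulGE ⊤ 1) (hN : ∀ x, N.d x ∈ N.smulGE ⊤ 1) (x : M.carrier) :
    f.toLin x - g.toLin x ∈ N.smulGE ⊤ 1 := by
  obtain ⟨h, _, hh⟩ := h
  rw [hh]
  exact add_mem (hN _) (map_mem_smulGE_top h (hM x))

/-- For a homotopy inverse `g` of `f`, both composites are congruent to the identity modulo `M A^+`,
hence bijective. -/
theorem isHomotopicallyMinimal (hpos : ∀ i < 0, 𝒜.gr i = ⊥) {M : DGModule 𝒜}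
    (hM : M.IsBoundedBelow) (hd : ∀ x, M.d x ∈ M.smulGE ⊤ 1) : M.IsHomotopicallyMinimal := by
  rintro f ⟨g, h1, h2⟩
  have b1 := bijective_of_sub_mem hpos hM _ (g.comp f).map_mem (h1.sub_mem hd hd)
  have b2 := bijective_of_sub_mem hpos hM _ (f.comp g).map_mem (h2.sub_mem hd hd)
  refine f.isIso_of_bijective ⟨?_, ?_⟩
  · exact Function.Injective.of_comp (f := g.toLin) b1.1
  · exact Function.Surjective.of_comp (g := g.toLin) b2.2

/-- Finitely generated dg modules are bounded below. -/
theorem isBoundedBelow_of_finite (hpos : ∀ i < 0, 𝒜.gr i = ⊥) {M : DGModule 𝒜}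
    (hM : Module.Finite Aᵐᵒᵖ M.carrier) : M.IsBoundedBelow := by
  have h1 : ∀ x : M.carrier, ∃ a : ℤ, ∀ i < a, M.proj i x = 0 := by
    refine M.induction ⟨0, by simp⟩ (fun i m hm => ⟨i, fun j hj => ?_⟩) ?_
    · exact M.proj_ne (by omega) hm
    · rintro x y ⟨a, ha⟩ ⟨b, hb⟩
      refine ⟨min a b, fun i hi => ?_⟩
      rw [map_add, ha i (by omega), hb i (by omega), add_zero]
  choose g hg using h1
  obtain ⟨S, hS⟩ := Module.Finite.fg_top (R := Aᵐᵒᵖ) (M := M.carrier)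
  obtain ⟨a, ha⟩ := (S.image g).bddBelow
  refine ⟨a, fun i hi => ?_⟩
  have key : ∀ x : M.carrier, ∀ i < a, M.proj i x = 0 := by
    intro x
    have hx : x ∈ Submodule.span Aᵐᵒᵖ (S : Set M.carrier) := by simp [hS]
    induction hx using Submodule.closure_induction with
    | zero => simp
    | add x y _ _ hx hy => intro i hi; rw [map_add, hx i hi, hy i hi, add_zero]
    | smul_mem r s hs =>
      refine 𝒜.induction (P := fun c => ∀ i < a, M.proj i (MulOpposite.op c • s) = 0) (by simp)
        (fun j c hc i hi => ?_) (fun x y hx hy i hi => ?_) r.unop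
      · by_cases hj : j < 0
        · rw [hpos j hj] at hc
          simp [(Submodule.mem_bot k).1 hc]
        · have h2 := M.smul_proj hc (i - j) s
          rw [sub_add_cancel] at h2
          have h3 : a ≤ g s := ha (by
            simp only [Finset.coe_image]
            exact ⟨s, hs, rfl⟩)
          rw [← h2, hg s _ (by omega), smul_zero]
      · rw [MulOpposite.op_add, add_smul, map_add, hx i hi, hy i hi, add_zero]
  rw [eq_bot_iff]
  intro x hx
  rw [AddSubgroup.mem_bot, ← M.proj_same hx, key x i hi]

/-! ### Homotopies -/

theorem Homotopic.of_sub_eq {M N : DGModule 𝒜} {f g f' g' : Hom M N} (h : Homotopic f g)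
    (e : ∀ x, f'.toLin x - g'.toLin x = f.toLin x - g.toLin x) : Homotopic f' g' := by
  obtain ⟨h, h1, h2⟩ := h
  exact ⟨h, h1, fun m => by rw [e, h2]⟩

theorem Homotopic.of_eq {M N : DGModule 𝒜} {f g : Hom M N} (e : ∀ x, f.toLin x = g.toLin x) :
    Homotopic f g :=
  ⟨0, fun _ _ _ => zero_mem _, fun m => by simp [e]⟩

theorem Homotopic.symm {M N : DGModule 𝒜} {f g : Hom M N} (h : Homotopic f g) :
    Homotopic g f := by
  obtain ⟨h, h1, h2⟩ := h
  refine ⟨-h, fun i m hm => neg_mem (h1 i m hm), fun m => ?_⟩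
  rw [← neg_sub, h2]
  simp only [LinearMap.neg_apply, map_neg]
  abel

theorem Homotopic.trans {M N : DGModule 𝒜} {f g e : Hom M N} (h : Homotopic f g)
    (h' : Homotopic g e) : Homotopic f e := by
  obtain ⟨h, h1, h2⟩ := h
  obtain ⟨h', h1', h2'⟩ := h'
  refine ⟨h + h', fun i m hm => add_mem (h1 i m hm) (h1' i m hm), fun m => ?_⟩
  rw [← sub_add_sub_cancel _ (g.toLin m), h2, h2']
  simp only [LinearMap.add_apply, map_add]
  abel

theorem Homotopic.comp_left {M N P : DGModule 𝒜} {f f' : Hom M N} (g : Hom N P)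
    (h : Homotopic f f') : Homotopic (g.comp f) (g.comp f') := by
  obtain ⟨h, h1, h2⟩ := h
  refine ⟨g.toLin.comp h, fun i m hm => g.map_mem _ _ (h1 i m hm), fun m => ?_⟩
  have := congrArg g.toLin (h2 m)
  simpa [Hom.comp, g.map_d] using this

theorem Homotopic.comp_right {M N P : DGModule 𝒜} {g g' : Hom N P} (h : Homotopic g g')
    (f : Hom M N) : Homotopic (g.comp f) (g'.comp f) := by
  obtain ⟨h, h1, h2⟩ := h
  refine ⟨h.comp f.toLin, fun i m hm => h1 _ _ (f.map_mem i m hm), fun m => ?_⟩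
  simpa [Hom.comp, f.map_d] using h2 (f.toLin m)

/-- The morphism `d h + h d` for an `A`-linear map `h` of degree `-1`. -/
def nullHom {M N : DGModule 𝒜} (h : M.carrier →ₗ[Aᵐᵒᵖ] N.carrier)
    (hdeg : ∀ i, ∀ m ∈ M.gr i, h m ∈ N.gr (i - 1)) : Hom M N where
  toLin :=
    { toFun := fun x => N.d (h x) + h (M.d x)
      map_add' := fun x y => by simp only [map_add]; abel
      map_smul' := fun r x => by
        refine M.induction (P := fun x => N.d (h (r • x)) + h (M.d (r • x)) =
          r • (N.d (h x) + h (M.d x))) (by simp) ?_ ?_ x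
        · intro i m hm
          have e1 := M.leibniz i m r.unop hm
          have e2 := N.leibniz (i - 1) (h m) r.unop (hdeg i m hm)
          rw [MulOpposite.op_unop] at e1 e2
          rw [map_smul, e1, e2, map_add, map_smul, smul_add]
          have e3 : (i - 1).negOnePow = - i.negOnePow := by
            rw [Int.negOnePow_sub, Int.negOnePow_one, mul_neg, mul_one]
          rcases Int.units_eq_one_or i.negOnePow with h2 | h2
          · rw [e3, h2, one_smul, Units.neg_smul, one_smul, map_smul]; abel
          · rw [e3, h2, neg_neg, one_smul, Units.neg_smul, one_smul, map_neg, map_smul]; abel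
        · intro a b ha hb
          simp only [smul_add, map_add] at ha hb ⊢
          rw [add_add_add_comm, ha, hb]
          abel }
  map_mem i m hm := by
    have h1 := N.d_mem _ _ (hdeg i m hm)
    have h2 := hdeg _ _ (M.d_mem i m hm)
    rw [sub_add_cancel] at h1
    rw [add_sub_cancel_right] at h2
    exact add_mem h1 h2
  map_d m := by
    change N.d (h (M.d m)) + h (M.d (M.d m)) = N.d (N.d (h m) + h (M.d m))
    rw [M.d_d, map_zero, map_add, N.d_d, zero_add, add_zero]

/-- The difference of two morphisms. -/
def Hom.sub {M N : DGModule 𝒜} (f g : Hom M N) : Hom M N where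
  toLin := f.toLin - g.toLin
  map_mem i m hm := sub_mem (f.map_mem i m hm) (g.map_mem i m hm)
  map_d m := by simp [f.map_d, g.map_d]

theorem id_sub_nullHom_homotopic {M : DGModule 𝒜} (h : M.carrier →ₗ[Aᵐᵒᵖ] M.carrier)
    (hdeg : ∀ i, ∀ m ∈ M.gr i, h m ∈ M.gr (i - 1)) :
    Homotopic ((Hom.id M).sub (nullHom h hdeg)) (Hom.id M) := by
  refine Homotopic.symm ⟨h, hdeg, fun m => ?_⟩
  simp [Hom.sub, Hom.id, nullHom]

/-- `M` is a homotopy retract of `N`, i.e. a retract in `dgHot(𝒜)`. -/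
def IsHomotopyRetract (M N : DGModule 𝒜) : Prop :=
  ∃ (i : Hom M N) (p : Hom N M), Homotopic (p.comp i) (Hom.id M)

theorem IsHomotopyRetract.trans {M N P : DGModule 𝒜} (h : IsHomotopyRetract M N)
    (h' : IsHomotopyRetract N P) : IsHomotopyRetract M P := by
  obtain ⟨i, p, h⟩ := h
  obtain ⟨j, q, h'⟩ := h'
  refine ⟨j.comp i, p.comp q, ?_⟩
  exact ((h'.comp_right i).comp_left p).trans h

theorem HotIso.isHomotopyRetract {M N : DGModule 𝒜} (h : HotIso M N) : IsHomotopyRetract M N := by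
  obtain ⟨f, g, h, _⟩ := h
  exact ⟨f, g, h⟩

theorem HotIso.symm {M N : DGModule 𝒜} (h : HotIso M N) : HotIso N M := by
  obtain ⟨f, g, h, h'⟩ := h
  exact ⟨g, f, h', h⟩

theorem IsHomotopyRetract.shift (n : ℤ) {M N : DGModule 𝒜} (h : IsHomotopyRetract M N) :
    IsHomotopyRetract (DGModule.shift n M) (DGModule.shift n N) := by
  obtain ⟨i, p, h, h1, h2⟩ := h
  have hom : ∀ {M N : DGModule 𝒜} (f : Hom M N) (m : M.carrier),
      f.toLin (n.negOnePow • M.d m) = n.negOnePow • N.d (f.toLin m) := by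
    intro M N f m
    rcases Int.units_eq_one_or n.negOnePow with h | h <;> simp [h, f.map_d]
  refine ⟨⟨i.toLin, fun j m hm => i.map_mem _ m hm, hom i⟩,
    ⟨p.toLin, fun j m hm => p.map_mem _ m hm, hom p⟩, n.negOnePow.val • h, fun j m hm => ?_,
    fun m => ?_⟩
  · have := h1 _ m hm
    rw [add_sub_right_comm] at this
    exact AddSubgroup.zsmul_mem _ this _
  · refine (h2 m).trans ?_
    change _ = n.negOnePow • M.d (n.negOnePow.val • h m) +
      n.negOnePow.val • h (n.negOnePow • M.d m)
    rcases Int.units_eq_one_or n.negOnePow with h | h <;> simp [h]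

/-- The cone of a morphism between homotopy retracts of `N` and `N'` is a homotopy retract of the
cone of a morphism from `N` to `N'`. -/
theorem IsHomotopyRetract.cone {M M' N N' : DGModule 𝒜} (f : Hom M M')
    (h : IsHomotopyRetract M N) (h' : IsHomotopyRetract M' N') :
    ∃ g : Hom N N', IsHomotopyRetract (DGModule.cone f) (DGModule.cone g) := by
  obtain ⟨i, p, h, hdeg, hh⟩ := h
  obtain ⟨i', p', h', hdeg', hh'⟩ := h'
  have eh : ∀ m, M.d (h m) = p.toLin (i.toLin m) - m - h (M.d m) := fun m => by
    have : p.toLin (i.toLin m) - m = _ := hh m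
    rw [this]; abel
  have eh' : ∀ m, M'.d (h' m) = p'.toLin (i'.toLin m) - m - h' (M'.d m) := fun m => by
    have : p'.toLin (i'.toLin m) - m = _ := hh' m
    rw [this]; abel
  -- With `g = i' f p` the squares over the inclusions and over the retractions commute only up to
  -- homotopy. The homotopies are built from `h` and `h'`, and they supply the off-diagonal terms of
  -- the two maps between the cones.
  refine ⟨i'.comp (f.comp p), ?_, ?_, ?_⟩
  · exact
    { toLin :=
        { toFun := fun x => (i'.toLin x.1 - i'.toLin (f.toLin (h x.2)), i.toLin x.2)
          map_add' := fun x y => by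
            refine Prod.ext ?_ ?_
            · change i'.toLin (x.1 + y.1) - i'.toLin (f.toLin (h (x.2 + y.2))) =
                i'.toLin x.1 - i'.toLin (f.toLin (h x.2)) +
                  (i'.toLin y.1 - i'.toLin (f.toLin (h y.2)))
              simp only [map_add]; abel
            · exact map_add i.toLin x.2 y.2
          map_smul' := fun r x => by
            refine Prod.ext ?_ ?_
            · change i'.toLin (r • x.1) - i'.toLin (f.toLin (h (r • x.2))) =
                r • (i'.toLin x.1 - i'.toLin (f.toLin (h x.2)))
              simp only [map_smul, smul_sub]
            · exact map_smul i.toLin r x.2 }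
      map_mem := fun j x hx => by
        have := hdeg _ _ hx.2
        rw [add_sub_cancel_right] at this
        exact ⟨(N'.gr j).sub_mem (i'.map_mem _ _ hx.1) (i'.map_mem _ _ (f.map_mem _ _ this)),
          i.map_mem _ _ hx.2⟩
      map_d := fun x => by
        refine Prod.ext ?_ ?_
        · change i'.toLin (M'.d x.1 + f.toLin x.2) - i'.toLin (f.toLin (h (-M.d x.2))) =
            N'.d (i'.toLin x.1 - i'.toLin (f.toLin (h x.2))) +
              i'.toLin (f.toLin (p.toLin (i.toLin x.2)))
          simp only [map_add, map_sub, map_neg, ← Hom.map_d, eh]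
          abel
        · change i.toLin (-M.d x.2) = -N.d (i.toLin x.2)
          rw [map_neg, i.map_d] }
  · exact
    { toLin :=
        { toFun := fun x => (p'.toLin x.1 + h' (f.toLin (p.toLin x.2)), p.toLin x.2)
          map_add' := fun x y => by
            refine Prod.ext ?_ ?_
            · change p'.toLin (x.1 + y.1) + h' (f.toLin (p.toLin (x.2 + y.2))) =
                p'.toLin x.1 + h' (f.toLin (p.toLin x.2)) +
                  (p'.toLin y.1 + h' (f.toLin (p.toLin y.2)))
              simp only [map_add]; abel
            · exact map_add p.toLin x.2 y.2
          map_smul' := fun r x => by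
            refine Prod.ext ?_ ?_
            · change p'.toLin (r • x.1) + h' (f.toLin (p.toLin (r • x.2))) =
                r • (p'.toLin x.1 + h' (f.toLin (p.toLin x.2)))
              simp only [map_smul, smul_add]
            · exact map_smul p.toLin r x.2 }
      map_mem := fun j x hx => by
        have := hdeg' _ _ (f.map_mem _ _ (p.map_mem _ _ hx.2))
        rw [add_sub_cancel_right] at this
        exact ⟨(M'.gr j).add_mem (p'.map_mem _ _ hx.1) this, p.map_mem _ _ hx.2⟩
      map_d := fun x => by
        refine Prod.ext ?_ ?_
        · change p'.toLin (N'.d x.1 + i'.toLin (f.toLin (p.toLin x.2))) +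
              h' (f.toLin (p.toLin (-N.d x.2))) =
            M'.d (p'.toLin x.1 + h' (f.toLin (p.toLin x.2))) + f.toLin (p.toLin x.2)
          simp only [map_add, map_neg, Hom.map_d, eh']
          abel
        · change p.toLin (-N.d x.2) = -M.d (p.toLin x.2)
          rw [map_neg, p.map_d] }
  -- The diagonal part is `(h', -h)`, with the sign of the shift; the corner `-h' f h` cancels the
  -- mixed terms coming from the off-diagonal corrections.
  · refine ⟨{ toFun := fun x => (h' x.1 - h' (f.toLin (h x.2)), -h x.2), map_add' := ?_,
              map_smul' := ?_ }, ?_, ?_⟩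
    · intro x y
      refine Prod.ext ?_ ?_
      · change h' (x.1 + y.1) - h' (f.toLin (h (x.2 + y.2))) =
          h' x.1 - h' (f.toLin (h x.2)) + (h' y.1 - h' (f.toLin (h y.2)))
        simp only [map_add]; abel
      · change -h (x.2 + y.2) = -h x.2 + -h y.2
        simp only [map_add]; abel
    · intro r x
      refine Prod.ext ?_ ?_
      · change h' (r • x.1) - h' (f.toLin (h (r • x.2))) = r • (h' x.1 - h' (f.toLin (h x.2)))
        simp only [map_smul, smul_sub]
      · change -h (r • x.2) = r • -h x.2
        simp only [map_smul, smul_neg]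
    · intro j x hx
      have h2 := hdeg _ _ hx.2
      have h3 := h2
      rw [add_sub_cancel_right] at h2
      rw [add_sub_right_comm] at h3
      exact ⟨(M'.gr (j - 1)).sub_mem (hdeg' _ _ hx.1) (hdeg' _ _ (f.map_mem _ _ h2)),
        (M.gr (j - 1 + 1)).neg_mem h3⟩
    · intro x
      refine Prod.ext ?_ ?_
      · change p'.toLin (i'.toLin x.1 - i'.toLin (f.toLin (h x.2))) +
            h' (f.toLin (p.toLin (i.toLin x.2))) - x.1 =
          M'.d (h' x.1 - h' (f.toLin (h x.2))) + f.toLin (-h x.2) +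
            (h' (M'.d x.1 + f.toLin x.2) - h' (f.toLin (h (-M.d x.2))))
        simp only [map_add, map_sub, map_neg, eh', ← Hom.map_d, eh]
        abel
      · change p.toLin (i.toLin x.2) - x.2 = -M.d (-h x.2) + -h (-M.d x.2)
        simp only [map_neg, eh]
        abel

theorem IsHomotopyRetract.of_prod (M N : DGModule 𝒜) : IsHomotopyRetract M (DGModule.prod M N) :=
  ⟨⟨LinearMap.inl _ _ _, fun _ _ hm => ⟨hm, zero_mem _⟩,
      fun _ => Prod.ext rfl (map_zero N.d).symm⟩,
    ⟨LinearMap.fst _ _ _, fun _ _ hm => hm.1, fun _ => rfl⟩, Homotopic.of_eq fun _ => rfl⟩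

/-! ### Idempotents -/

open Polynomial in
/-- A polynomial in an endomorphism. -/
noncomputable def Hom.aeval {M : DGModule 𝒜} (e : Hom M M) (p : ℤ[X]) : Hom M M where
  toLin := Polynomial.aeval (R := ℤ) (show Module.End Aᵐᵒᵖ M.carrier from e.toLin) p
  map_mem i m hm := by
    induction p using Polynomial.induction_on' with
    | add p q hp hq => rw [map_add]; exact add_mem hp hq
    | monomial n a =>
      have : ∀ n : ℕ, ((show Module.End Aᵐᵒᵖ M.carrier from e.toLin) ^ n) m ∈ M.gr i := by
        intro n
        induction n with
        | zero => exact hm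
        | succ n ih => rw [pow_succ', Module.End.mul_apply]; exact e.map_mem i _ ih
      rw [aeval_monomial, Algebra.algebraMap_eq_smul_one, smul_mul_assoc, one_mul]
      exact AddSubgroup.zsmul_mem _ (this n) a
  map_d m := by
    induction p using Polynomial.induction_on' with
    | add p q hp hq => rw [map_add]; simp [hp, hq]
    | monomial n a =>
      have : ∀ n : ℕ, ((show Module.End Aᵐᵒᵖ M.carrier from e.toLin) ^ n) (M.d m) =
          M.d (((show Module.End Aᵐᵒᵖ M.carrier from e.toLin) ^ n) m) := by
        intro n
        induction n with
        | zero => rfl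
        | succ n ih =>
          rw [pow_succ', Module.End.mul_apply, ih, Module.End.mul_apply]
          exact e.map_d _
      rw [aeval_monomial, Algebra.algebraMap_eq_smul_one, smul_mul_assoc, one_mul,
        LinearMap.smul_apply, LinearMap.smul_apply, this, map_zsmul]

/-- Idempotents modulo `M A^+` lift. -/
theorem exists_idempotent (hpos : ∀ i < 0, 𝒜.gr i = ⊥) {M : DGModule 𝒜}
    (hM : Module.Finite Aᵐᵒᵖ M.carrier) (e : Hom M M)
    (he : ∀ x, e.toLin (e.toLin x) - e.toLin x ∈ M.smulGE ⊤ 1) :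
    ∃ e' q : Hom M M, (∀ x, e'.toLin (e'.toLin x) = e'.toLin x) ∧
      ∀ x, e'.toLin x - e.toLin x = q.toLin (e.toLin (e.toLin x) - e.toLin x) := by
  let ε : Module.End Aᵐᵒᵖ M.carrier := e.toLin
  -- `ε ^ 2 - ε` maps into `M A^+`, so it is locally nilpotent; finite generation makes the exponent
  -- uniform, and a single polynomial in `e` is then idempotent.
  obtain ⟨n, hn⟩ := LinearMap.exists_pow_eq_zero_of_finite (ε ^ 2 - ε)
    (exists_pow_apply_eq_zero hpos (isBoundedBelow_of_finite hpos hM) (ε ^ 2 - ε)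
      (fun i m hm => by
        rw [pow_two]
        exact sub_mem (e.map_mem i _ (e.map_mem i m hm)) (e.map_mem i m hm))
      (fun x => by rw [pow_two]; exact he x))
  obtain ⟨p, q, r, h1, h2⟩ := exists_idempotent_polynomial n
  refine ⟨e.aeval p, e.aeval q, fun x => ?_, fun x => ?_⟩
  · have := congrArg (Polynomial.aeval (R := ℤ) ε) h1
    simp only [map_sub, map_mul, map_pow, Polynomial.aeval_X, hn, zero_mul] at this
    have h3 := LinearMap.congr_fun this x
    exact sub_eq_zero.1 h3
  · have := congrArg (Polynomial.aeval (R := ℤ) ε) h2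
    simp only [map_sub, map_mul, Polynomial.aeval_X, pow_two] at this
    exact LinearMap.congr_fun this x

/-- Idempotents in `dgMod(𝒜)` split. -/
theorem exists_splitting {M : DGModule 𝒜} (e : Hom M M)
    (he : ∀ x, e.toLin (e.toLin x) = e.toLin x) :
    ∃ (N : DGModule 𝒜) (i : Hom N M) (p : Hom M N), (∀ x, p.toLin (i.toLin x) = x) ∧
      ∀ x, i.toLin (p.toLin x) = e.toLin x := by
  let S : DGSub M :=
    { toSubmodule := LinearMap.range e.toLin
      proj_mem := by
        rintro i _ ⟨x, rfl⟩
        exact ⟨M.proj i x, e.map_proj i x⟩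
      d_mem := by
        rintro _ ⟨x, rfl⟩
        exact ⟨M.d x, e.map_d x⟩ }
  refine ⟨S.toDGModule, ⟨S.toSubmodule.subtype, fun _ _ h => h, fun _ => rfl⟩,
    ⟨e.toLin.rangeRestrict, fun i m hm => e.map_mem i m hm, fun m => Subtype.ext (e.map_d m)⟩,
    ?_, fun _ => rfl⟩
  rintro ⟨_, x, rfl⟩
  exact Subtype.ext (he x)

/-! ### Reduction modulo `M A^+` -/

/-- Thus `A` acts on `M / M A^+` through its degree zero part, and `A^0`-linear maps between such
quotients are automatically `A`-linear. -/
theorem smul_sub_smul_proj_zero_mem (hpos : ∀ i < 0, 𝒜.gr i = ⊥) (M : DGModule 𝒜) (a : A)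
    (x : M.carrier) :
    MulOpposite.op a • x - MulOpposite.op (𝒜.proj 0 a) • x ∈ M.smulGE ⊤ 1 := by
  refine 𝒜.induction (P := fun a => MulOpposite.op a • x - MulOpposite.op (𝒜.proj 0 a) • x ∈
    M.smulGE ⊤ 1) (by simp) (fun i a ha => ?_) (fun a b ha hb => ?_) a
  · rcases lt_trichotomy i 0 with hi | rfl | hi
    · rw [hpos i hi] at ha
      simp [(Submodule.mem_bot k).1 ha]
    · rw [𝒜.proj_same ha, sub_self]; exact zero_mem _
    · rw [𝒜.proj_ne hi.ne' ha, MulOpposite.op_zero, zero_smul, sub_zero]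
      exact smul_mem_smulGE (by omega) ha Submodule.mem_top
  · simp only [map_add, MulOpposite.op_add, add_smul]
    rw [add_sub_add_comm]
    exact add_mem ha hb

/-- A map which is `A^0`-linear modulo `X ⊇ Q A^+` has a quasi-inverse modulo `X` which is
`A`-linear, if `Q` is projective. -/
theorem exists_quasi_inverse (hpos : ∀ i < 0, 𝒜.gr i = ⊥) (hss : IsSemisimpleRing 𝒜.A0)
    {P Q : DGModule 𝒜} (hQ : Module.Projective Aᵐᵒᵖ Q.carrier) (X : Submodule Aᵐᵒᵖ Q.carrier)
    (hX : Q.smulGE ⊤ 1 ≤ X) (φ : P.carrier →+ Q.carrier)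
    (hφ : ∀ (r : 𝒜.A0ᵐᵒᵖ) (x : P.carrier), φ (r • x) - r • φ x ∈ X)
    (hφ' : ∀ x ∈ P.smulGE ⊤ 1, φ x ∈ X) :
    ∃ Ψ : Q.carrier →ₗ[Aᵐᵒᵖ] P.carrier, (∀ x, φ (Ψ (φ x)) - φ x ∈ X) ∧
      ∀ x ∈ X, Ψ x ∈ P.smulGE ⊤ 1 := by
  let _ : Module 𝒜.A0ᵐᵒᵖ (P.carrier ⧸ P.smulGE ⊤ 1) :=
    Module.compHom _ (RingHom.op 𝒜.A0incl)
  let _ : Module 𝒜.A0ᵐᵒᵖ (Q.carrier ⧸ X) := Module.compHom _ (RingHom.op 𝒜.A0incl)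
  let φq : (P.carrier ⧸ P.smulGE ⊤ 1) →+ (Q.carrier ⧸ X) :=
    QuotientAddGroup.map (P.smulGE ⊤ 1).toAddSubgroup X.toAddSubgroup φ hφ'
  have hq : ∀ x, φq ((P.smulGE ⊤ 1).mkQ x) = X.mkQ (φ x) := fun _ => rfl
  let φ0 : (P.carrier ⧸ P.smulGE ⊤ 1) →ₗ[𝒜.A0ᵐᵒᵖ] (Q.carrier ⧸ X) :=
    { φq with
      map_smul' := fun r x => by
        obtain ⟨x, rfl⟩ := (P.smulGE ⊤ 1).mkQ_surjective x
        exact (Submodule.Quotient.eq X).2 (hφ r x) }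
  -- Semisimplicity of `A^0` enters here. The quasi-inverse `ψ` is `A`-linear because `A` acts
  -- through `A^0` on both sides; projectivity of `Q` then lifts it to `Ψ`.
  obtain ⟨ψ, hψ⟩ := φ0.exists_comp_comp_eq_self
  have key : ∀ {Z : DGModule 𝒜} (Y : Submodule Aᵐᵒᵖ Z.carrier) (_ : Z.smulGE ⊤ 1 ≤ Y) (a : A)
      (y : Z.carrier ⧸ Y), MulOpposite.op a • y = MulOpposite.op (𝒜.proj 0 a) • y := by
    intro Z Y hY a y
    obtain ⟨y, rfl⟩ := Y.mkQ_surjective y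
    exact (Submodule.Quotient.eq Y).2 (hY (smul_sub_smul_proj_zero_mem hpos Z a y))
  let ψA : (Q.carrier ⧸ X) →ₗ[Aᵐᵒᵖ] (P.carrier ⧸ P.smulGE ⊤ 1) :=
    { ψ with
      map_smul' := fun r x => by
        change ψ (MulOpposite.op r.unop • x) = MulOpposite.op r.unop • ψ x
        rw [key X hX, key _ le_rfl]
        let r0 : 𝒜.A0 := ⟨𝒜.proj 0 r.unop, (DirectSum.decompose 𝒜.gr r.unop 0).2⟩
        exact ψ.map_smul (MulOpposite.op r0) x }
  obtain ⟨Ψ, hΨ⟩ := Module.projective_lifting_property (P.smulGE ⊤ 1).mkQ (ψA.comp X.mkQ)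
    (Submodule.mkQ_surjective _)
  have hΨ' : ∀ y, (P.smulGE ⊤ 1).mkQ (Ψ y) = ψ (X.mkQ y) := fun y => LinearMap.congr_fun hΨ y
  refine ⟨Ψ, fun x => ?_, fun x hx => ?_⟩
  · refine (Submodule.Quotient.eq X).1 ?_
    change X.mkQ (φ (Ψ (φ x))) = X.mkQ (φ x)
    rw [← hq, hΨ', ← hq]
    exact hψ ((P.smulGE ⊤ 1).mkQ x)
  · rw [← Submodule.Quotient.mk_eq_zero]
    change (P.smulGE ⊤ 1).mkQ (Ψ x) = 0
    rw [hΨ', Submodule.mkQ_apply, (Submodule.Quotient.mk_eq_zero X).2 hx, map_zero]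

/-- If `Y` is a submodule of a projective module `Q` with `Q A^+ ⊆ X`, then inverse images are
compatible with multiplication by `A^+` modulo `A^{≥ 2}`. -/
theorem mem_smulGE_comap (hpos : ∀ i < 0, 𝒜.gr i = ⊥) (hss : IsSemisimpleRing 𝒜.A0)
    {P Q : DGModule 𝒜} (hQ : Module.Projective Aᵐᵒᵖ Q.carrier) (X : Submodule Aᵐᵒᵖ Q.carrier)
    (hX : Q.smulGE ⊤ 1 ≤ X) (g : P.carrier →ₗ[Aᵐᵒᵖ] Q.carrier) {x : P.carrier}
    (hx : x ∈ P.smulGE ⊤ 1) (hgx : g x ∈ Q.smulGE X 1 ⊔ Q.smulGE ⊤ 2) :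
    x ∈ P.smulGE (X.comap g) 1 ⊔ P.smulGE ⊤ 2 := by
  obtain ⟨Ψ, h1, h2⟩ := exists_quasi_inverse hpos hss hQ X hX g.toAddMonoidHom
    (fun r x => by
      change g (MulOpposite.op (𝒜.A0incl r.unop) • x) -
        MulOpposite.op (𝒜.A0incl r.unop) • g x ∈ X
      rw [map_smul, sub_self]; exact zero_mem _)
    (fun x hx => hX (map_mem_smulGE_top g hx))
  -- Since `g Ψ g` and `g` agree modulo `X`, the map `1 - Ψ g` sends all of `P` into the inverse
  -- image of `X`. The rest, `Ψ (g x)`, has higher order because `Ψ` maps `X` into `P A^+`.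
  have h3 : x - Ψ (g x) ∈ P.smulGE (X.comap g) 1 :=
    map_mem_smulGE (LinearMap.id - Ψ.comp g) (fun y _ => by
      have := neg_mem (h1 y)
      rw [neg_sub] at this
      simpa using this) hx
  have h4 : Ψ (g x) ∈ P.smulGE ⊤ 2 := by
    obtain ⟨y, hy, z, hz, hyz⟩ := Submodule.mem_sup.1 hgx
    rw [← hyz, map_add]
    exact add_mem (smulGE_smulGE hpos ⊤ 1 1 (map_mem_smulGE Ψ h2 hy)) (map_mem_smulGE_top Ψ hz)
  rw [← sub_add_cancel x (Ψ (g x))]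
  exact add_mem (Submodule.mem_sup_left h3) (Submodule.mem_sup_right h4)

/-! ### Removing the contractible part of a finitely generated projective dg module. -/

theorem d_mem_smulGE_one {M : DGModule 𝒜} {x : M.carrier} (hx : x ∈ M.smulGE ⊤ 1) :
    M.d x ∈ M.smulGE ⊤ 1 := by
  rw [← mulAPlus_eq] at hx ⊢
  exact M.mulAPlus.d_mem x hx

/-- The error term in the Leibniz rule involves only `d(a)`, whose components have positive degree.
Hence `d` is linear modulo `M A^+`, as `exists_quasi_inverse` requires. -/
theorem d_smul_sub_mem (hpos : ∀ i < 0, 𝒜.gr i = ⊥) (M : DGModule 𝒜) (a : A) (x : M.carrier) :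
    M.d (MulOpposite.op a • x) - MulOpposite.op a • M.d x ∈ M.smulGE ⊤ 1 := by
  refine M.induction (P := fun x => M.d (MulOpposite.op a • x) - MulOpposite.op a • M.d x ∈
    M.smulGE ⊤ 1) (by simp) (fun i m hm => ?_) (fun x y hx hy => ?_) x
  · rw [M.leibniz i m a hm, add_sub_cancel_left]
    exact negOnePow_smul_mem _ _ (dA_mem hpos a Submodule.mem_top)
  · simp only [smul_add, map_add, add_sub_add_comm]
    exact add_mem hx hy

/-- Every finitely generated projective dg module is homotopy equivalent to a direct summand `N`
with `d(N) ⊆ N A^+`. -/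
theorem exists_minimal_retract (hpos : ∀ i < 0, 𝒜.gr i = ⊥) (hss : IsSemisimpleRing 𝒜.A0)
    {M : DGModule 𝒜} (hfin : Module.Finite Aᵐᵒᵖ M.carrier)
    (hproj : Module.Projective Aᵐᵒᵖ M.carrier) :
    ∃ (N : DGModule 𝒜) (i : Hom N M) (p : Hom M N), (∀ x, p.toLin (i.toLin x) = x) ∧
      Homotopic (i.comp p) (Hom.id M) ∧ ∀ x, N.d x ∈ N.smulGE ⊤ 1 := by
  obtain ⟨K0, hK0, -⟩ := exists_quasi_inverse hpos hss hproj (M.smulGE ⊤ 1) le_rfl M.d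
    (fun r x => d_smul_sub_mem hpos M _ x) (fun x hx => d_mem_smulGE_one hx)
  -- The quasi-inverse of `d` need not be homogeneous; its component of degree `-1` still satisfies
  -- `d K d = d` modulo `M A^+` and can serve as a homotopy.
  obtain ⟨K, hKdeg, hK⟩ := exists_component K0 (-1)
  have hdKd : ∀ x, M.d (K (M.d x)) - M.d x ∈ M.smulGE ⊤ 1 := by
    refine M.induction (by simp) (fun i m hm => ?_) (fun x y hx hy => ?_)
    · have h1 := proj_mem_smulGE hpos (i + 1 + -1 + 1) (hK0 m)
      have h2 : M.d m ∈ M.gr (i + 1 + -1 + 1) := by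
        rw [neg_add_cancel_right]; exact M.d_mem i m hm
      rw [map_sub, M.proj_same h2, ← M.d_proj, ← hK _ _ (M.d_mem i m hm)] at h1
      exact h1
    · simp only [map_add, add_sub_add_comm]
      exact add_mem hx hy
  have hKdeg' : ∀ i, ∀ m ∈ M.gr i, K m ∈ M.gr (i - 1) := hKdeg
  let t : Hom M M := (Hom.id M).sub (nullHom K hKdeg')
  have ht : ∀ x, t.toLin x = x - (M.d (K x) + K (M.d x)) := fun _ => rfl
  have htid : Homotopic t (Hom.id M) := id_sub_nullHom_homotopic K hKdeg'
  have hdt : ∀ x, M.d (t.toLin x) ∈ M.smulGE ⊤ 1 := fun x => by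
    rw [ht, map_sub, map_add, M.d_d, zero_add, ← neg_sub]
    exact neg_mem (hdKd x)
  have htt : ∀ z, M.d z ∈ M.smulGE ⊤ 1 →
      t.toLin (t.toLin z) - t.toLin z ∈ M.smulGE ⊤ 1 := by
    intro z hz
    have e1 : M.d (K (t.toLin z)) ∈ M.smulGE ⊤ 1 := by
      have h1 := neg_mem (hdKd (K z))
      have h2 : M.d (K (K (M.d z))) ∈ M.smulGE ⊤ 1 :=
        d_mem_smulGE_one (map_mem_smulGE_top K (map_mem_smulGE_top K hz))
      have : M.d (K (t.toLin z)) = -(M.d (K (M.d (K z))) - M.d (K z)) - M.d (K (K (M.d z))) := by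
        rw [ht]; simp only [map_sub, map_add]; abel
      rw [this]
      exact sub_mem h1 h2
    rw [ht (t.toLin z), sub_sub_cancel_left]
    exact neg_mem (add_mem e1 (map_mem_smulGE_top K (hdt z)))
  -- The map `t = 1 - (d K + K d)` is idempotent modulo `M A^+` only on elements whose differential
  -- lies in `M A^+`, as `K d K = K` is not assumed. All values of `t` are such elements, so the
  -- square of `t` is idempotent modulo `M A^+` everywhere.
  let e : Hom M M := t.comp t
  have he : ∀ x, e.toLin x = t.toLin (t.toLin x) := fun _ => rfl
  obtain ⟨e', q, he', heq⟩ := exists_idempotent hpos hfin e (fun x => by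
    have h1 := htt (t.toLin x) (hdt x)
    have h2 := map_mem_smulGE_top t.toLin h1
    rw [map_sub] at h2
    have := add_mem h2 h1
    rw [sub_add_sub_cancel] at this
    exact this)
  have hee : Homotopic e (Hom.id M) := (htid.comp_left t).trans htid
  have he'id : Homotopic e' (Hom.id M) := by
    refine Homotopic.trans ?_ hee
    -- The difference `e' - e` is `q` applied to `e e - e`, and `e e` is homotopic to `e`.
    refine ((hee.comp_left e).comp_left q).of_sub_eq fun x => ?_
    rw [heq, map_sub]
    rfl
  obtain ⟨N, i, p, hpi, hip⟩ := exists_splitting e' he'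
  refine ⟨N, i, p, hpi, he'id.of_sub_eq fun x => ?_, fun x => ?_⟩
  · exact congrArg (· - x) (hip x)
  · have h1 : i.toLin x = e'.toLin (i.toLin x) := by rw [← hip, hpi]
    have h2 : M.d (i.toLin x) ∈ M.smulGE ⊤ 1 := by
      rw [h1, ← sub_add_cancel (e'.toLin (i.toLin x)) (e.toLin (i.toLin x)), map_add, heq]
      refine add_mem (d_mem_smulGE_one (map_mem_smulGE_top q.toLin ?_)) (hdt _)
      have h3 := htt (t.toLin (i.toLin x)) (hdt _)
      have h4 := map_mem_smulGE_top t.toLin h3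
      rw [map_sub] at h4
      have := add_mem h4 h3
      rw [sub_add_sub_cancel] at this
      exact this
    have h3 := map_mem_smulGE_top p.toLin h2
    rwa [p.map_d, hpi] at h3

/-! ### Nilpotent minimal dg modules -/

/-- The submodules `Y` of `M` which contain `M A^+` and on whose image in `M / M A^+` the map
`M / M A^+ → M A^+ / M A^{≥ 2}` induced by the differential of a minimal dg module `M` is
nilpotent. -/
inductive IsNilSub (M : DGModule 𝒜) : Submodule Aᵐᵒᵖ M.carrier → Prop
  | base : IsNilSub M (M.smulGE ⊤ 1)
  | step {Y Z : Submodule Aᵐᵒᵖ M.carrier} : IsNilSub M Y → M.smulGE ⊤ 1 ≤ Z →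
      (∀ z ∈ Z, M.d z ∈ M.smulGE Y 1 ⊔ M.smulGE ⊤ 2) → IsNilSub M Z

theorem IsNilSub.le {M : DGModule 𝒜} {Y : Submodule Aᵐᵒᵖ M.carrier} (h : IsNilSub M Y) :
    M.smulGE ⊤ 1 ≤ Y := by
  cases h with
  | base => exact le_rfl
  | step _ h _ => exact h

/-- This links the two filtrations used for a cone, where one starts inside the end of the other. -/
theorem IsNilSub.anti {M : DGModule 𝒜} {Y Z : Submodule Aᵐᵒᵖ M.carrier} (h : IsNilSub M Y)
    (hZ : M.smulGE ⊤ 1 ≤ Z) (hZY : Z ≤ Y) : IsNilSub M Z := by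
  cases h with
  | base => rw [le_antisymm hZY hZ]; exact .base
  | step h _ hd => exact .step h hZ fun z hz => hd z (hZY hz)

theorem map_mem_smulGE_sup {M N : DGModule 𝒜} (f : M.carrier →ₗ[Aᵐᵒᵖ] N.carrier)
    {Y : Submodule Aᵐᵒᵖ M.carrier} {Z : Submodule Aᵐᵒᵖ N.carrier} (h : ∀ y ∈ Y, f y ∈ Z)
    {x : M.carrier} (hx : x ∈ M.smulGE Y 1 ⊔ M.smulGE ⊤ 2) :
    f x ∈ N.smulGE Z 1 ⊔ N.smulGE ⊤ 2 := by
  obtain ⟨y, hy, z, hz, rfl⟩ := Submodule.mem_sup.1 hx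
  rw [map_add]
  exact add_mem (Submodule.mem_sup_left (map_mem_smulGE f h hy))
    (Submodule.mem_sup_right (map_mem_smulGE_top f hz))

theorem map_smulGE_top {M N : DGModule 𝒜} (f : M.carrier →ₗ[Aᵐᵒᵖ] N.carrier)
    (hf : Function.Surjective f) (n : ℤ) : (M.smulGE ⊤ n).map f = N.smulGE ⊤ n := by
  refine le_antisymm (Submodule.map_le_iff_le_comap.2 fun x hx => map_mem_smulGE_top f hx)
    (Submodule.span_le.2 ?_)
  rintro _ ⟨j, hj, a, ha, y, _, rfl⟩
  obtain ⟨x, rfl⟩ := hf y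
  exact ⟨_, smul_mem_smulGE hj ha Submodule.mem_top, map_smul f _ _⟩

theorem IsNilSub.map {M N : DGModule 𝒜} (p : Hom M N) (hp : Function.Surjective p.toLin)
    {Y : Submodule Aᵐᵒᵖ M.carrier} (h : IsNilSub M Y) : IsNilSub N (Y.map p.toLin) := by
  induction h with
  | base => rw [map_smulGE_top _ hp]; exact .base
  | @step Y Z _ hZ hd ih =>
    refine .step ih ?_ ?_
    · rw [← map_smulGE_top _ hp]; exact Submodule.map_mono hZ
    · rintro _ ⟨z, hz, rfl⟩
      rw [← p.map_d]
      exact map_mem_smulGE_sup p.toLin (fun y hy => Submodule.mem_map_of_mem hy) (hd z hz)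

/-- Finitely generated projective minimal dg modules on which the differential is nilpotent modulo
`A^{≥ 2}`. -/
structure IsMinimalCell (M : DGModule 𝒜) : Prop where
  finite : Module.Finite Aᵐᵒᵖ M.carrier
  projective : Module.Projective Aᵐᵒᵖ M.carrier
  minimal : ∀ x, M.d x ∈ M.smulGE ⊤ 1
  nil : IsNilSub M ⊤

/-- Here the retraction is strict. Minimality and nilpotence are transported along `p`, projectivity
through the splitting. -/
theorem IsMinimalCell.of_retract {M N : DGModule 𝒜} (hM : IsMinimalCell M) (i : Hom N M)
    (p : Hom M N) (h : ∀ x, p.toLin (i.toLin x) = x) : IsMinimalCell N := by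
  have hsurj : Function.Surjective p.toLin := fun x => ⟨_, h x⟩
  have := hM.finite
  have := hM.projective
  refine ⟨Module.Finite.of_surjective p.toLin hsurj,
    Module.Projective.of_split i.toLin p.toLin (LinearMap.ext h), fun x => ?_, ?_⟩
  · have h1 := map_mem_smulGE_top p.toLin (hM.minimal (i.toLin x))
    rwa [p.map_d, h] at h1
  · have h1 := hM.nil.map p hsurj
    rwa [Submodule.map_top, LinearMap.range_eq_top.2 hsurj] at h1

theorem IsMinimalCell.shift (n : ℤ) {M : DGModule 𝒜} (hM : IsMinimalCell M) :
    IsMinimalCell (DGModule.shift n M) := by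
  refine ⟨hM.finite, hM.projective, fun x => negOnePow_smul_mem (M.smulGE ⊤ 1) n (hM.minimal x),
    ?_⟩
  have : ∀ Y, IsNilSub M Y → IsNilSub (DGModule.shift n M) Y := by
    intro Y hY
    induction hY with
    | base => exact .base
    | @step Y Z _ hZ hd ih =>
      exact .step ih hZ fun z hz =>
        negOnePow_smul_mem (M.smulGE Y 1 ⊔ M.smulGE ⊤ 2) n (hd z hz)
  exact this _ hM.nil

/-- The differential kills `A^0` and raises positive degrees to degrees `≥ 2`, so it even maps into
`A^{≥ 2}` and one step of nilpotence suffices. -/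
theorem isMinimalCell_regular (hpos : ∀ i < 0, 𝒜.gr i = ⊥) (h0 : ∀ a ∈ 𝒜.gr 0, 𝒜.d a = 0) :
    IsMinimalCell (regular 𝒜) := by
  let e : Aᵐᵒᵖ ≃ₗ[Aᵐᵒᵖ] (regular 𝒜).carrier :=
    { toFun := MulOpposite.unop
      invFun := MulOpposite.op
      map_add' := fun _ _ => rfl
      map_smul' := fun _ _ => rfl
      left_inv := fun _ => rfl
      right_inv := fun _ => rfl }
  have key : ∀ {n : ℤ} {j : ℤ} {a : A}, n ≤ j → a ∈ 𝒜.gr j → a ∈ (regular 𝒜).smulGE ⊤ n := by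
    intro n j a hj ha
    have : a = MulOpposite.op a • (show (regular 𝒜).carrier from (1 : A)) :=
      (one_mul a).symm
    rw [this]
    exact smul_mem_smulGE hj ha Submodule.mem_top
  have hA : ∀ a : A, 𝒜.d a ∈ (regular 𝒜).smulGE ⊤ 2 := by
    refine 𝒜.induction ?_ (fun i a ha => ?_) (fun a b ha hb => ?_)
    · rw [map_zero]; exact zero_mem ((regular 𝒜).smulGE ⊤ 2)
    · rcases lt_trichotomy i 0 with hi | rfl | hi
      · rw [hpos i hi] at ha
        rw [(Submodule.mem_bot k).1 ha, map_zero]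
        exact zero_mem ((regular 𝒜).smulGE ⊤ 2)
      · rw [h0 a ha]; exact zero_mem ((regular 𝒜).smulGE ⊤ 2)
      · exact key (by omega) (𝒜.d_mem i a ha)
    · rw [map_add]; exact add_mem (S := Submodule Aᵐᵒᵖ (regular 𝒜).carrier) ha hb
  exact ⟨Module.Finite.equiv e, Module.Projective.of_equiv e,
    fun x => smulGE_mono le_rfl (by norm_num) (hA x),
    .step .base le_top fun z _ => Submodule.mem_sup_right (hA z)⟩

/-- The cone of a morphism of minimal cells is homotopy equivalent to a minimal cell. -/
theorem IsMinimalCell.exists_cone (hpos : ∀ i < 0, 𝒜.gr i = ⊥) (hss : IsSemisimpleRing 𝒜.A0)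
    {M N : DGModule 𝒜} (f : Hom M N) (hM : IsMinimalCell M) (hN : IsMinimalCell N) :
    ∃ E, IsMinimalCell E ∧ IsHomotopyRetract (DGModule.cone f) E := by
  have := hM.finite
  have := hM.projective
  have := hN.finite
  have := hN.projective
  have hfin : Module.Finite Aᵐᵒᵖ (DGModule.cone f).carrier :=
    inferInstanceAs (Module.Finite Aᵐᵒᵖ (N.carrier × M.carrier))
  have hproj : Module.Projective Aᵐᵒᵖ (DGModule.cone f).carrier :=
    inferInstanceAs (Module.Projective Aᵐᵒᵖ (N.carrier × M.carrier))
  obtain ⟨E, i, p, hpi, hip, hmin⟩ := exists_minimal_retract hpos hss hfin hproj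
  have hsurj : Function.Surjective p.toLin := fun x => ⟨_, hpi x⟩
  refine ⟨E, ⟨Module.Finite.of_surjective p.toLin hsurj,
    Module.Projective.of_split i.toLin p.toLin (LinearMap.ext hpi), hmin, ?_⟩, p, i, hip⟩
  let inl : N.carrier →ₗ[Aᵐᵒᵖ] (DGModule.cone f).carrier := LinearMap.inl Aᵐᵒᵖ N.carrier M.carrier
  let inr : M.carrier →ₗ[Aᵐᵒᵖ] (DGModule.cone f).carrier := LinearMap.inr Aᵐᵒᵖ N.carrier M.carrier
  let fst : (DGModule.cone f).carrier →ₗ[Aᵐᵒᵖ] N.carrier := LinearMap.fst Aᵐᵒᵖ N.carrier M.carrier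
  let snd : (DGModule.cone f).carrier →ₗ[Aᵐᵒᵖ] M.carrier := LinearMap.snd Aᵐᵒᵖ N.carrier M.carrier
  have hsum : ∀ x, inl (fst x) + inr (snd x) = x := fun x =>
    Prod.ext (add_zero x.1) (zero_add x.2)
  have hdl : ∀ n, (DGModule.cone f).d (inl n) = inl (N.d n) := fun n =>
    Prod.ext (by
      change N.d n + f.toLin 0 = N.d n
      rw [map_zero, add_zero]) (by
      change -M.d 0 = 0
      rw [map_zero, neg_zero])
  have hsd : ∀ x, snd ((DGModule.cone f).d x) = -M.d (snd x) := fun _ => rfl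
  have hsl : ∀ n, snd (inl n) = 0 := fun _ => rfl
  have hsr : ∀ m, snd (inr m) = m := fun _ => rfl
  -- Nilpotence of `E` is assembled from the subobject `N` of the cone, by images under `p`, and
  -- then from the quotient `M`, by inverse images under `snd ∘ i`.
  have h1 : ∀ Y, IsNilSub N Y → IsNilSub E (Y.map (p.toLin.comp inl) ⊔ E.smulGE ⊤ 1) := by
    intro Y hY
    induction hY with
    | base =>
      rw [sup_eq_right.2 (Submodule.map_le_iff_le_comap.2 fun x hx => map_mem_smulGE_top _ hx)]
      exact .base
    | @step Y Z _ hZ hd ih =>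
      refine .step ih le_sup_right fun z hz => ?_
      obtain ⟨_, ⟨y, hy, rfl⟩, w, hw, rfl⟩ := Submodule.mem_sup.1 hz
      rw [map_add]
      refine add_mem ?_ (Submodule.mem_sup_right (d_mem_smulGE_two hpos hmin hw))
      rw [LinearMap.comp_apply, ← p.map_d, hdl, ← LinearMap.comp_apply]
      exact map_mem_smulGE_sup _
        (fun y hy => Submodule.mem_sup_left (Submodule.mem_map_of_mem hy)) (hd y hy)
  have h2 : ∀ Y, IsNilSub M Y → IsNilSub E (Y.comap (snd.comp i.toLin)) := by
    intro Y hY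
    induction hY with
    | base =>
      -- The two halves meet here: if the `M`-component of `i x` lies in `M A^+`, then `x = p (i x)`
      -- is in the image of `N` modulo `E A^+`.
      refine (h1 ⊤ hN.nil).anti (fun x hx => map_mem_smulGE_top _ hx) fun x hx => ?_
      rw [← hpi x, ← hsum (i.toLin x), map_add]
      exact add_mem (Submodule.mem_sup_left ⟨_, Submodule.mem_top, rfl⟩)
        (Submodule.mem_sup_right (map_mem_smulGE_top p.toLin (map_mem_smulGE_top inr hx)))
    | @step Y Z hY hZ hd ih =>
      refine .step ih (fun x hx => hZ (map_mem_smulGE_top _ hx)) fun x hx => ?_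
      rw [Submodule.comap_comp]
      -- Being a product of the required kind is checked in the cone, where the differential is
      -- explicit, and pulled back along `i`. The `N`-component causes no trouble, since all of `N`
      -- lies in the inverse image of `Y` under `snd`.
      refine mem_smulGE_comap hpos hss hproj (Y.comap snd)
        (fun x hx => hY.le (map_mem_smulGE_top _ hx)) i.toLin (hmin x) ?_
      have h3 := map_mem_smulGE_top fst (map_mem_smulGE_top i.toLin (hmin x))
      rw [← hsum (i.toLin (E.d x))]
      refine add_mem (Submodule.mem_sup_left (map_mem_smulGE inl (fun y _ => ?_) h3))
        (map_mem_smulGE_sup inr (fun y hy => ?_) (Y := Y) ?_)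
      · rw [Submodule.mem_comap, hsl]; exact zero_mem _
      · rwa [Submodule.mem_comap, hsr]
      · rw [i.map_d, hsd]
        exact neg_mem (hd _ hx)
  have := h2 ⊤ hM.nil
  rwa [Submodule.comap_top] at this

/-! ### Minimal cell models of perfect dg modules. -/

/-- Retracts are the right induction hypothesis: direct summands cost nothing, and idempotents need
to be split only once, at the end. -/
theorem IsPerfect.exists_isHomotopyRetract (hpos : ∀ i < 0, 𝒜.gr i = ⊥)
    (hss : IsSemisimpleRing 𝒜.A0) (h0 : ∀ a ∈ 𝒜.gr 0, 𝒜.d a = 0) {M : DGModule 𝒜}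
    (hM : M.IsPerfect) : ∃ N, IsMinimalCell N ∧ IsHomotopyRetract M N := by
  induction hM with
  | regular =>
    exact ⟨_, isMinimalCell_regular hpos h0, Hom.id _, Hom.id _, Homotopic.of_eq fun _ => rfl⟩
  | iso _ h ih =>
    obtain ⟨P, hP, hr⟩ := ih
    exact ⟨P, hP, h.symm.isHomotopyRetract.trans hr⟩
  | shift n _ ih =>
    obtain ⟨P, hP, hr⟩ := ih
    exact ⟨_, hP.shift n, hr.shift n⟩
  | cone f _ _ ih ih' =>
    obtain ⟨P, hP, hr⟩ := ih
    obtain ⟨P', hP', hr'⟩ := ih'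
    obtain ⟨g, hg⟩ := IsHomotopyRetract.cone f hr hr'
    obtain ⟨E, hE, hr''⟩ := IsMinimalCell.exists_cone hpos hss g hP hP'
    exact ⟨E, hE, hg.trans hr''⟩
  | @summand M M' _ ih =>
    obtain ⟨P, hP, hr⟩ := ih
    exact ⟨P, hP, (IsHomotopyRetract.of_prod M M').trans hr⟩

/-- The homotopy idempotent `i p` is idempotent modulo `N A^+` because `N` is minimal. It is
therefore homotopic to a strict idempotent, whose image is the wanted cell. -/
theorem IsHomotopyRetract.exists_hotIso (hpos : ∀ i < 0, 𝒜.gr i = ⊥) {M N : DGModule 𝒜}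
    (hN : IsMinimalCell N) (h : IsHomotopyRetract M N) : ∃ P, IsMinimalCell P ∧ HotIso M P := by
  obtain ⟨i, p, h⟩ := h
  have hee : Homotopic ((i.comp p).comp (i.comp p)) (i.comp p) :=
    (h.comp_right p).comp_left i
  obtain ⟨e, q, he, heq⟩ := exists_idempotent hpos hN.finite (i.comp p)
    (hee.sub_mem hN.minimal hN.minimal)
  have hei : Homotopic e (i.comp p) := (hee.comp_left q).of_sub_eq fun x => by
    rw [heq, map_sub]; rfl
  obtain ⟨P, j, r, hrj, hjr⟩ := exists_splitting e he
  refine ⟨P, hN.of_retract j r hrj, r.comp i, p.comp j, ?_, ?_⟩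
  · have h1 : Homotopic (p.comp (e.comp i)) (p.comp ((i.comp p).comp i)) :=
      (hei.comp_right i).comp_left p
    have h2 : Homotopic (p.comp ((i.comp p).comp i)) (Hom.id M) :=
      Homotopic.trans (g := p.comp i) ((h.comp_left i).comp_left p) h
    refine (h1.trans h2).of_sub_eq fun x => ?_
    exact congrArg (fun y => p.toLin y - x) (hjr (i.toLin x))
  · have h1 : Homotopic (r.comp ((i.comp p).comp j)) (r.comp (e.comp j)) :=
      (hei.symm.comp_right j).comp_left r
    have h2 : Homotopic (r.comp (e.comp j)) (Hom.id P) := .of_eq fun x => by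
      change r.toLin (e.toLin (j.toLin x)) = x
      rw [← hjr, hrj, hrj]
    exact (h1.trans h2).of_sub_eq fun _ => rfl

/-- Every perfect dg module is homotopy equivalent to a minimal cell. -/
theorem IsPerfect.exists_hotIso (hpos : ∀ i < 0, 𝒜.gr i = ⊥)
    (hss : IsSemisimpleRing 𝒜.A0) (h0 : ∀ a ∈ 𝒜.gr 0, 𝒜.d a = 0) {M : DGModule 𝒜}
    (hM : M.IsPerfect) : ∃ N, IsMinimalCell N ∧ HotIso M N := by
  obtain ⟨N, hN, h⟩ := hM.exists_isHomotopyRetract hpos hss h0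
  exact h.exists_hotIso hpos hN

/-- Both sides are homotopically minimal, so both composites of a homotopy equivalence with its
homotopy inverse are isomorphisms; hence `M` and `N` are isomorphic in `dgMod`. -/
theorem IsHomotopicallyMinimal.isMinimalCell (hpos : ∀ i < 0, 𝒜.gr i = ⊥) {M N : DGModule 𝒜}
    (hM : M.IsHomotopicallyMinimal) (hN : IsMinimalCell N) (h : HotIso M N) :
    IsMinimalCell M := by
  have hN' := isHomotopicallyMinimal hpos (isBoundedBelow_of_finite hpos hN.finite) hN.minimal
  obtain ⟨f, g, h1, h2⟩ := h
  have key : ∀ {P : DGModule 𝒜} {e : Hom P P}, Homotopic e (Hom.id P) → e.IsHomotopyEquiv :=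
    fun {P e} h => ⟨Hom.id P, h, h⟩
  have b1 := (hM _ (key h1)).bijective
  have b2 := (hN' _ (key h2)).bijective
  obtain ⟨f', h3, _⟩ := f.isIso_of_bijective
    ⟨Function.Injective.of_comp (f := g.toLin) b1.1,
      Function.Surjective.of_comp (g := g.toLin) b2.2⟩
  exact hN.of_retract f f' fun x => LinearMap.congr_fun (congrArg Hom.toLin h3) x

/-! ### The submodules `M_{≤ i}` -/

theorem mem_le {M : DGModule 𝒜} {i j : ℤ} (h : j ≤ i) {m : M.carrier} (hm : m ∈ M.gr j) :
    m ∈ M.le i :=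
  Submodule.subset_span ⟨j, h, hm⟩

theorem le_induction {M : DGModule 𝒜} {i : ℤ} {P : M.carrier → Prop} (zero : P 0)
    (add : ∀ x y, P x → P y → P (x + y))
    (smul : ∀ j ≤ i, ∀ m ∈ M.gr j, ∀ l, ∀ a ∈ 𝒜.gr l, P (MulOpposite.op a • m))
    {x : M.carrier} (hx : x ∈ M.le i) : P x := by
  induction hx using Submodule.closure_induction with
  | zero => exact zero
  | add x y _ _ hx hy => exact add x y hx hy
  | smul_mem r s hs =>
    obtain ⟨j, hj, hs⟩ := hs
    refine 𝒜.induction (P := fun a => P (MulOpposite.op a • s)) (by simpa using zero)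
      (fun l a ha => smul j hj s hs l a ha) (fun a b ha hb => ?_) r.unop
    rw [MulOpposite.op_add, add_smul]
    exact add _ _ ha hb

theorem mem_smulGE_of_mem_le {M : DGModule 𝒜} {i j : ℤ} (h : i < j) {x : M.carrier}
    (hx : x ∈ M.le i) (hxj : x ∈ M.gr j) : x ∈ M.smulGE ⊤ 1 := by
  rw [← M.proj_same hxj]
  refine le_induction (P := fun x => M.proj j x ∈ M.smulGE ⊤ 1) (by simp)
    (fun x y hx hy => ?_) (fun s hs m hm l a ha => ?_) hx
  · rw [map_add]; exact add_mem hx hy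
  · have h1 := M.smul_mem s l m a hm ha
    by_cases hsl : s + l = j
    · subst hsl
      rw [M.proj_same h1]
      exact smul_mem_smulGE (by omega) ha Submodule.mem_top
    · rw [M.proj_ne hsl h1]; exact zero_mem _

theorem mem_le_of_mem_smulGE (hpos : ∀ i < 0, 𝒜.gr i = ⊥) {M : DGModule 𝒜} {i : ℤ}
    {x : M.carrier} (hx : x ∈ M.smulGE ⊤ 1) (hxi : x ∈ M.gr (i + 1)) : x ∈ M.le i := by
  rw [← M.proj_same hxi]
  refine smulGE_top_induction hpos (P := fun x => M.proj (i + 1) x ∈ M.le i) (by simp)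
    (fun x y hx hy => ?_) (fun j hj a ha s m hm => ?_) hx
  · rw [map_add]; exact add_mem hx hy
  · have h1 := M.smul_mem s j m a hm ha
    by_cases hsl : s + j = i + 1
    · rw [← hsl, M.proj_same h1]
      exact Submodule.smul_mem _ _ (mem_le (by omega) hm)
    · rw [M.proj_ne hsl h1]; exact zero_mem _

/-- An element of degree `i + 1` is generated from degrees `≤ i` exactly when it lies in `M A^+`.
This is applied to the differential of an element of degree `i`. -/
theorem d_mem_le_iff (hpos : ∀ i < 0, 𝒜.gr i = ⊥) (M : DGModule 𝒜) :
    (∀ i, ∀ m ∈ M.le i, M.d m ∈ M.le i) ↔ ∀ x, M.d x ∈ M.smulGE ⊤ 1 := by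
  constructor
  · intro h
    refine M.induction (by simp) (fun i m hm => ?_) (fun x y hx hy => ?_)
    · exact mem_smulGE_of_mem_le (lt_add_one i) (h i m (mem_le le_rfl hm)) (M.d_mem i m hm)
    · rw [map_add]; exact add_mem hx hy
  · intro h i m hm
    refine le_induction (P := fun x => M.d x ∈ M.le i) (by simp) (fun x y hx hy => ?_)
      (fun j hj m hm l a ha => ?_) hm
    · rw [map_add]; exact add_mem hx hy
    · rw [M.leibniz j m a hm]
      refine add_mem (Submodule.smul_mem _ _ ?_)
        (negOnePow_smul_mem _ _ (Submodule.smul_mem _ _ (mem_le hj hm)))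
      have := mem_le_of_mem_smulGE hpos (h m) (M.d_mem j m hm)
      refine Submodule.span_mono ?_ this
      rintro x ⟨s, hs, hx⟩
      exact ⟨s, hs.trans hj, hx⟩

/-! ### The modules `L̂` -/

/-- The element `l ⊗ a` of `L ⊗_ℤ A`. -/
def tmulInt (𝒜 : DGAlgebra k A) {L : Type u} [AddCommGroup L] (a : A) (l : L) :
    (tensorInt 𝒜 L).carrier := a ⊗ₜ[ℤ] l

theorem op_smul_tmulInt_one {L : Type u} [AddCommGroup L] (a : A) (l : L) :
    MulOpposite.op a • tmulInt 𝒜 1 l = tmulInt 𝒜 a l := by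
  change ((1 : A) * a) ⊗ₜ[ℤ] l = a ⊗ₜ[ℤ] l
  rw [one_mul]

section Hat

variable (h0 : ∀ a ∈ 𝒜.gr 0, 𝒜.d a = 0) (L : Type u) [AddCommGroup L] [Module 𝒜.A0ᵐᵒᵖ L]

/-- The projection from `L ⊗_ℤ A` to `L̂`. -/
noncomputable def hatMk : (tensorInt 𝒜 L).carrier →ₗ[Aᵐᵒᵖ] (hat h0 L).carrier :=
  Submodule.mkQ _

/-- The inclusion of `L` in `L̂`. -/
noncomputable def hatIncl : L →+ (hat h0 L).carrier :=
  (hatMk h0 L).toAddMonoidHom.comp (TensorProduct.mk ℤ A L 1).toAddMonoidHom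

theorem hatMk_surjective : Function.Surjective (hatMk h0 L) :=
  Submodule.mkQ_surjective _

variable {L}

theorem hatMk_tmulInt (a : A) (l : L) :
    hatMk h0 L (tmulInt 𝒜 a l) = MulOpposite.op a • hatIncl h0 L l := by
  rw [← op_smul_tmulInt_one, map_smul]
  rfl

theorem hatIncl_smul (r : 𝒜.A0) (l : L) :
    hatIncl h0 L (MulOpposite.op r • l) = MulOpposite.op (𝒜.A0incl r) • hatIncl h0 L l := by
  rw [← hatMk_tmulInt]
  symm
  refine (Submodule.Quotient.eq _).2 (Submodule.subset_span ⟨0, 1, r, l,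
    SetLike.GradedOne.one_mem, ?_⟩)
  rw [mul_one]
  rfl

theorem hatIncl_mem (l : L) : hatIncl h0 L l ∈ (hat h0 L).gr 0 :=
  ⟨(1 : A) ⊗ₜ[ℤ] l, AddSubgroup.subset_closure ⟨1, SetLike.GradedOne.one_mem, l, rfl⟩, rfl⟩

theorem d_hatIncl (l : L) : (hat h0 L).d (hatIncl h0 L l) = 0 := by
  have h1 : (tensorInt 𝒜 L).d ((1 : A) ⊗ₜ[ℤ] l) = 0 := by
    change (𝒜.d 1) ⊗ₜ[ℤ] l = 0
    rw [h0 1 SetLike.GradedOne.one_mem, TensorProduct.zero_tmul]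
  exact (congrArg (hatMk h0 L) h1).trans (map_zero _)

theorem hat_induction {P : (hat h0 L).carrier → Prop} (zero : P 0)
    (add : ∀ x y, P x → P y → P (x + y))
    (smul : ∀ i, ∀ a ∈ 𝒜.gr i, ∀ l, P (MulOpposite.op a • hatIncl h0 L l))
    (x : (hat h0 L).carrier) : P x := by
  obtain ⟨x, rfl⟩ := hatMk_surjective h0 L x
  refine TensorProduct.induction_on (motive := fun x => P (hatMk h0 L x)) x ?_ (fun a l => ?_)
    (fun x y hx hy => ?_)
  · exact (map_zero (hatMk h0 L)).symm ▸ zero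
  · change P (hatMk h0 L (tmulInt 𝒜 a l))
    rw [hatMk_tmulInt]
    refine 𝒜.induction (P := fun a => P (MulOpposite.op a • hatIncl h0 L l)) (by simpa using zero)
      (fun i a ha => smul i a ha l) (fun a b ha hb => ?_) a
    rw [MulOpposite.op_add, add_smul]
    exact add _ _ ha hb
  · exact (map_add (hatMk h0 L) x y).symm ▸ add _ _ hx hy

theorem hat_map_mem {N : DGModule 𝒜} (f : (hat h0 L).carrier →ₗ[Aᵐᵒᵖ] N.carrier) (n : ℤ)
    (hf : ∀ l, f (hatIncl h0 L l) ∈ N.gr n) (i : ℤ) (x : (hat h0 L).carrier)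
    (hx : x ∈ (hat h0 L).gr i) : f x ∈ N.gr (i + n) := by
  obtain ⟨y, hy, rfl⟩ := hx
  have : AddSubgroup.closure {x | ∃ a ∈ 𝒜.gr i, ∃ l : L, x = a ⊗ₜ[ℤ] l} ≤
      (N.gr (i + n)).comap (f.comp (hatMk h0 L)).toAddMonoidHom := by
    refine (AddSubgroup.closure_le _).2 ?_
    rintro _ ⟨a, ha, l, rfl⟩
    change f (hatMk h0 L (tmulInt 𝒜 a l)) ∈ N.gr (i + n)
    rw [hatMk_tmulInt, map_smul, add_comm]
    exact N.smul_mem _ _ _ _ (hf l) ha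
  exact this hy

theorem hat_gr_eq_bot (hpos : ∀ i < 0, 𝒜.gr i = ⊥) (i : ℤ) (hi : i < 0) :
    (hat h0 L).gr i = ⊥ := by
  rw [eq_bot_iff]
  rintro _ ⟨y, hy, rfl⟩
  have : AddSubgroup.closure {x | ∃ a ∈ 𝒜.gr i, ∃ l : L, x = a ⊗ₜ[ℤ] l} ≤ ⊥ := by
    rw [AddSubgroup.closure_le]
    rintro _ ⟨a, ha, l, rfl⟩
    rw [hpos i hi] at ha
    rw [(Submodule.mem_bot k).1 ha, TensorProduct.zero_tmul]
    exact zero_mem _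
  have hy' : y = 0 := (AddSubgroup.mem_bot).1 (this hy)
  rw [hy', map_zero]
  exact zero_mem _

/-- Universal property of `L̂` as an induced module: the balancing relations are respected because
`φ` is `A^0`-linear. -/
theorem exists_hatLift {N : DGModule 𝒜} (φ : L →+ N.carrier)
    (hφ : ∀ (r : 𝒜.A0) (l : L),
      φ (MulOpposite.op r • l) = MulOpposite.op (𝒜.A0incl r) • φ l) :
    ∃ f : (hat h0 L).carrier →ₗ[Aᵐᵒᵖ] N.carrier, ∀ l, f (hatIncl h0 L l) = φ l := by
  let g : A ⊗[ℤ] L →+ N.carrier := TensorProduct.liftAddHom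
    { toFun := fun a => (DistribSMul.toAddMonoidHom N.carrier (MulOpposite.op a)).comp φ
      map_zero' := by ext l; simp
      map_add' := fun a b => by ext l; simp [add_smul] }
    (fun n a l => by
      change MulOpposite.op (n • a) • φ l = MulOpposite.op a • φ (n • l)
      rw [MulOpposite.op_smul, smul_assoc, map_zsmul, smul_comm])
  have hg : ∀ a l, g (a ⊗ₜ[ℤ] l) = MulOpposite.op a • φ l := fun _ _ => rfl
  let G : (tensorInt 𝒜 L).carrier →ₗ[Aᵐᵒᵖ] N.carrier :=
    { g with
      map_smul' := fun r x => by
        change g (r • (show A ⊗[ℤ] L from x)) = r • g x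
        refine TensorProduct.induction_on
          (motive := fun x => g (r • x) = r • g x) x (by simp) (fun a l => ?_)
          (fun x y hx hy => ?_)
        · change g ((a * r.unop) ⊗ₜ[ℤ] l) = r • g (a ⊗ₜ[ℤ] l)
          rw [hg, hg, MulOpposite.op_mul, MulOpposite.op_unop, mul_smul]
        · rw [smul_add, map_add, map_add, hx, hy, smul_add] }
  refine ⟨Submodule.liftQ _ G ?_, fun l => ?_⟩
  · refine Submodule.span_le.2 ?_
    rintro _ ⟨j, a, r, l, _, rfl⟩
    change g ((𝒜.A0incl r * a) ⊗ₜ[ℤ] l - a ⊗ₜ[ℤ] (MulOpposite.op r • l)) = 0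
    rw [map_sub, hg, hg, hφ, MulOpposite.op_mul, mul_smul, sub_self]
  · have : g ((1 : A) ⊗ₜ[ℤ] l) = φ l := by rw [hg]; simp
    exact this

/-- Modulo `L̂ A^+` only coefficients in `A^0` survive, and these move across the tensor sign into
`L`. -/
theorem exists_sub_hatIncl_mem (hpos : ∀ i < 0, 𝒜.gr i = ⊥) (x : (hat h0 L).carrier) :
    ∃ l, x - hatIncl h0 L l ∈ (hat h0 L).smulGE ⊤ 1 := by
  refine hat_induction h0 (P := fun x => ∃ l, x - hatIncl h0 L l ∈ (hat h0 L).smulGE ⊤ 1)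
    ⟨0, by simp⟩ ?_ (fun i a ha l => ?_) x
  · rintro x y ⟨l, hl⟩ ⟨l', hl'⟩
    refine ⟨l + l', ?_⟩
    rw [map_add, add_sub_add_comm]
    exact add_mem hl hl'
  · rcases lt_trichotomy i 0 with hi | rfl | hi
    · rw [hpos i hi] at ha
      exact ⟨0, by simp [(Submodule.mem_bot k).1 ha]⟩
    · let r : 𝒜.A0 := ⟨a, ha⟩
      refine ⟨MulOpposite.op r • l, ?_⟩
      rw [hatIncl_smul]
      change MulOpposite.op a • _ - MulOpposite.op a • _ ∈ _
      rw [sub_self]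
      exact zero_mem _
    · refine ⟨0, ?_⟩
      rw [map_zero, sub_zero]
      exact smul_mem_smulGE (by omega) ha Submodule.mem_top

end Hat

/-! ### Subquotients -/

theorem Iso.symm {M N : DGModule 𝒜} (h : Iso M N) : Iso N M := by
  obtain ⟨f, g, h1, h2⟩ := h
  exact ⟨g, f, h2, h1⟩

theorem Iso.trans {M N P : DGModule 𝒜} (h : Iso M N) (h' : Iso N P) : Iso M P := by
  obtain ⟨f, hf⟩ := h
  obtain ⟨g, hg⟩ := h'
  exact ⟨g.comp f, (g.comp f).isIso_of_bijective (hg.bijective.comp hf.bijective)⟩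

/-- The projection `G → G / F`. -/
def subquotMk {M : DGModule 𝒜} (F G : DGSub M) : Hom G.toDGModule (subquot F G) where
  toLin := Submodule.mkQ _
  map_mem _ _ hm := ⟨_, hm, rfl⟩
  map_d _ := rfl

theorem subquotMk_surjective {M : DGModule 𝒜} (F G : DGSub M) :
    Function.Surjective (subquotMk F G).toLin :=
  Submodule.mkQ_surjective _

theorem subquotMk_eq_zero {M : DGModule 𝒜} (F G : DGSub M) (x : G.toSubmodule) :
    (subquotMk F G).toLin x = 0 ↔ x.1 ∈ F.toSubmodule :=
  Submodule.Quotient.mk_eq_zero _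

theorem subquot_iso {M N : DGModule 𝒜} (F G : DGSub M) (φ : Hom G.toDGModule N)
    (hs : Function.Surjective φ.toLin)
    (hk : ∀ x : G.toSubmodule, φ.toLin x = 0 ↔ x.1 ∈ F.toSubmodule) : Iso (subquot F G) N := by
  let f : Hom (subquot F G) N :=
    { toLin := Submodule.liftQ _ φ.toLin fun x hx => (hk x).2 hx
      map_mem := by
        rintro i _ ⟨x, hx, rfl⟩
        exact φ.map_mem i x hx
      map_d := fun y => by
        obtain ⟨x, rfl⟩ := subquotMk_surjective F G y
        exact φ.map_d x }
  have hf : ∀ x, f.toLin ((subquotMk F G).toLin x) = φ.toLin x := fun _ => rfl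
  refine ⟨f, f.isIso_of_bijective ⟨(injective_iff_map_eq_zero f.toLin).2 fun y hy => ?_,
    fun z => ?_⟩⟩
  · obtain ⟨x, rfl⟩ := subquotMk_surjective F G y
    exact (subquotMk_eq_zero F G x).2 ((hk x).1 hy)
  · obtain ⟨x, rfl⟩ := hs z
    exact ⟨_, hf x⟩

/-! ### Filtered dg modules are bounded below and minimal -/

/-- The subquotient `{l_i} L̂_i` lives in degrees `≥ -l_i`, and there are finitely many of them. -/
theorem IsFilt.isBoundedBelow (hpos : ∀ i < 0, 𝒜.gr i = ⊥) {h0 : ∀ a ∈ 𝒜.gr 0, 𝒜.d a = 0}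
    {M : DGModule 𝒜} (h : M.IsFilt h0) : M.IsBoundedBelow := by
  obtain ⟨n, F, l, hbot, htop, -, hF⟩ := h
  obtain ⟨c, hc⟩ := (Set.finite_range fun i => -l i).bddBelow
  refine ⟨c, fun j hj => ?_⟩
  have key : ∀ i, ∀ x ∈ (F i).toSubmodule, x ∈ M.gr j → x = 0 := by
    intro i
    induction i using Fin.induction with
    | zero => intro x hx _; rwa [hbot, Submodule.mem_bot] at hx
    | succ i ih =>
      intro x hx hxj
      obtain ⟨hle, L, _, _, _, φ, hφ⟩ := hF i
      have h1 : φ.toLin ((subquotMk (F i.castSucc) (F i.succ)).toLin ⟨x, hx⟩) ∈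
          (hat h0 L).gr (j + l i) :=
        φ.map_mem j _ ((subquotMk _ _).map_mem j ⟨x, hx⟩ hxj)
      have hci : c ≤ -l i := hc ⟨i, rfl⟩
      rw [hat_gr_eq_bot h0 hpos _ (by omega)] at h1
      have h2 := hφ.bijective.1 ((AddSubgroup.mem_bot.1 h1).trans (map_zero φ.toLin).symm)
      exact ih x ((subquotMk_eq_zero _ _ ⟨x, hx⟩).1 h2) hxj
  rw [eq_bot_iff]
  intro x hx
  exact key (Fin.last n) x (by rw [htop]; exact Submodule.mem_top) hx

/-- The order of the shifts matters here. A generator of the `i`-th step has degree `-l_i` and its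
differential lies in the previous step, which is generated in degrees `≤ -l_i`; being of degree
`-l_i + 1`, it lies in `M A^+`. -/
theorem IsFilt.minimal (hpos : ∀ i < 0, 𝒜.gr i = ⊥) {h0 : ∀ a ∈ 𝒜.gr 0, 𝒜.d a = 0}
    {M : DGModule 𝒜} (h : M.IsFilt h0) : ∀ x, M.d x ∈ M.smulGE ⊤ 1 := by
  obtain ⟨n, F, l, hbot, htop, hl, hF⟩ := h
  have key : ∀ i : Fin (n + 1),
      (∀ c, (∀ j : Fin n, j.castSucc < i → -l j ≤ c) → (F i).toSubmodule ≤ M.le c) ∧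
      ∀ x ∈ (F i).toSubmodule, M.d x ∈ M.smulGE ⊤ 1 := by
    intro i
    induction i using Fin.induction with
    | zero =>
      rw [hbot]
      exact ⟨fun _ _ => bot_le, fun x hx => by
        rw [(Submodule.mem_bot _).1 hx, map_zero]; exact zero_mem _⟩
    | succ i ih =>
      obtain ⟨ih1, ih2⟩ := ih
      have hprev : (F i.castSucc).toSubmodule ≤ M.le (-l i) :=
        ih1 _ fun j hj => neg_le_neg (hl (Fin.castSucc_lt_castSucc_iff.1 hj).le)
      obtain ⟨hle, L, _, _, _, φ, hφ⟩ := hF i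
      let ψ : Hom (F i.succ).toDGModule (shift (l i) (hat h0 L)) := φ.comp (subquotMk _ _)
      have hψs : Function.Surjective ψ.toLin := hφ.bijective.2.comp (subquotMk_surjective _ _)
      have hψk : ∀ x : (F i.succ).toSubmodule, ψ.toLin x = 0 → x.1 ∈ (F i.castSucc).toSubmodule :=
        fun x hx => (subquotMk_eq_zero _ _ x).1
          (hφ.bijective.1 (hx.trans (map_zero φ.toLin).symm))
      have hlift : ∀ z : (hat h0 L).carrier, ∃ x : (F i.succ).toSubmodule, ψ.toLin x = z ∧
          x.1 ∈ M.le (-l i) ∧ M.d x.1 ∈ M.smulGE ⊤ 1 := by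
        refine hat_induction h0 ?_ ?_ ?_
        · exact ⟨0, map_zero _, zero_mem _, by
            rw [ZeroMemClass.coe_zero, map_zero]; exact zero_mem _⟩
        · rintro z z' ⟨x, hx, hx1, hx2⟩ ⟨x', hx', hx1', hx2'⟩
          refine ⟨x + x', ?_, add_mem hx1 hx1', ?_⟩
          · exact (map_add ψ.toLin x x').trans (congrArg₂ (· + ·) hx hx')
          · rw [Submodule.coe_add, map_add]; exact add_mem hx2 hx2'
        · intro j a ha e
          obtain ⟨y, hy⟩ := hψs (hatIncl h0 L e)
          -- A homogeneous lift is needed for the comparison of degrees; `d x` falls into the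
          -- previous step because the generators of `L̂` are cycles.
          let x := (F i.succ).toDGModule.proj (-l i) y
          have hxgr : x.1 ∈ M.gr (-l i) := (F i.succ).toDGModule.proj_mem (-l i) y
          have hx : ψ.toLin x = hatIncl h0 L e := by
            rw [ψ.map_proj, hy]
            refine proj_same _ ?_
            change _ ∈ (hat h0 L).gr (-l i + l i)
            rw [neg_add_cancel]
            exact hatIncl_mem h0 e
          have hdx : M.d x.1 ∈ (F i.castSucc).toSubmodule := by
            refine hψk ((F i.succ).toDGModule.d x) ?_
            rw [ψ.map_d, hx]
            change (l i).negOnePow • (hat h0 L).d (hatIncl h0 L e) = 0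
            rw [d_hatIncl, smul_zero]
          have hdx' := mem_smulGE_of_mem_le (lt_add_one _) (hprev hdx) (M.d_mem _ _ hxgr)
          refine ⟨MulOpposite.op a • x, ?_, ?_, ?_⟩
          · rw [map_smul, hx]; rfl
          · exact Submodule.smul_mem (M.le (-l i)) _ (mem_le le_rfl hxgr)
          · change M.d (MulOpposite.op a • x.1) ∈ _
            rw [M.leibniz _ _ _ hxgr]
            exact add_mem (Submodule.smul_mem _ _ hdx')
              (negOnePow_smul_mem _ _ (dA_mem hpos a Submodule.mem_top))
      have hdec : ∀ y ∈ (F i.succ).toSubmodule, ∃ x x' : M.carrier, y = x + x' ∧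
          x' ∈ (F i.castSucc).toSubmodule ∧ x ∈ M.le (-l i) ∧ M.d x ∈ M.smulGE ⊤ 1 := by
        intro y hy
        obtain ⟨x, hx, hx1, hx2⟩ := hlift (ψ.toLin ⟨y, hy⟩)
        refine ⟨x.1, y - x.1, by abel, hψk (⟨y, hy⟩ - x) ?_, hx1, hx2⟩
        exact (map_sub ψ.toLin _ _).trans (sub_eq_zero.2 hx.symm)
      constructor
      · intro c hc y hy
        obtain ⟨x, x', rfl, hx', hx, -⟩ := hdec y hy
        have hmono : M.le (-l i) ≤ M.le c := Submodule.span_mono fun x ⟨s, hs, hx⟩ =>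
          ⟨s, hs.trans (hc i Fin.castSucc_lt_succ), hx⟩
        exact hmono (add_mem hx (hprev hx'))
      · intro y hy
        obtain ⟨x, x', rfl, hx', -, hx⟩ := hdec y hy
        rw [map_add]
        exact add_mem hx (ih2 x' hx')
  intro x
  exact (key (Fin.last n)).2 x (by rw [htop]; exact Submodule.mem_top)

/-! ### Reductions of morphisms -/

/-- An `A`-linear map as an `A^0`-linear map. -/
def restrictA0 {M N : DGModule 𝒜} (f : M.carrier →ₗ[Aᵐᵒᵖ] N.carrier) :
    M.carrier →ₗ[𝒜.A0ᵐᵒᵖ] N.carrier :=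
  { f with map_smul' := fun r x => f.map_smul (MulOpposite.op (𝒜.A0incl r.unop)) x }

/-- The map `M̄ → N̄` induced by an `A`-linear map `M → N`. -/
def barMap {M N : DGModule 𝒜} (f : M.carrier →ₗ[Aᵐᵒᵖ] N.carrier) :
    M.bar.carrier →ₗ[Aᵐᵒᵖ] N.bar.carrier :=
  Submodule.mapQ M.mulAPlus.toSubmodule N.mulAPlus.toSubmodule f fun x hx => by
    rw [mulAPlus_eq] at hx
    rw [Submodule.mem_comap, mulAPlus_eq]
    exact map_mem_smulGE_top f hx

/-- The projection `M → M̄`. -/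
def barMk (M : DGModule 𝒜) : M.carrier →ₗ[Aᵐᵒᵖ] M.bar.carrier :=
  M.mulAPlus.toSubmodule.mkQ

theorem barMk_surjective (M : DGModule 𝒜) : Function.Surjective M.barMk :=
  Submodule.mkQ_surjective _

theorem barMk_eq_zero {M : DGModule 𝒜} {x : M.carrier} :
    M.barMk x = 0 ↔ x ∈ M.smulGE ⊤ 1 := by
  rw [← mulAPlus_eq]
  exact Submodule.Quotient.mk_eq_zero _

theorem bar_finite (hpos : ∀ i < 0, 𝒜.gr i = ⊥) {M : DGModule 𝒜}
    (hM : Module.Finite Aᵐᵒᵖ M.carrier) : Module.Finite 𝒜.A0ᵐᵒᵖ M.bar.carrier := by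
  have : Module.Finite Aᵐᵒᵖ M.bar.carrier := Module.Finite.of_surjective M.barMk M.barMk_surjective
  obtain ⟨S, hS⟩ := Module.Finite.fg_top (R := Aᵐᵒᵖ) (M := M.bar.carrier)
  refine ⟨⟨S, eq_top_iff.2 fun x _ => ?_⟩⟩
  have hx : x ∈ Submodule.span Aᵐᵒᵖ (S : Set M.bar.carrier) := by simp [hS]
  induction hx using Submodule.closure_induction with
  | zero => exact zero_mem _
  | add x y _ _ hx hy => exact add_mem (hx trivial) (hy trivial)
  | smul_mem r s hs =>
    obtain ⟨y, rfl⟩ := M.barMk_surjective s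
    have h1 := barMk_eq_zero.2 (smul_sub_smul_proj_zero_mem hpos M r.unop y)
    rw [map_sub, sub_eq_zero, map_smul, map_smul, MulOpposite.op_unop] at h1
    rw [h1]
    let r0 : 𝒜.A0 := ⟨𝒜.proj 0 r.unop, (DirectSum.decompose 𝒜.gr r.unop 0).2⟩
    exact Submodule.smul_mem _ (MulOpposite.op r0) (Submodule.subset_span hs)

theorem barLength_ne_top (hpos : ∀ i < 0, 𝒜.gr i = ⊥) (hss : IsSemisimpleRing 𝒜.A0)
    {M : DGModule 𝒜} (hM : Module.Finite Aᵐᵒᵖ M.carrier) : M.barLength ≠ ⊤ := by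
  have := bar_finite hpos hM
  exact Module.length_ne_top

/-! ### Minimal cells are filtered -/

/-- In degree `a + 1` the multiples by `A^{≥ 2}` vanish, and from `Y A^{≥ 1}` only `Y^a A^1`
remains, which is zero by induction. So `d` kills the lowest part of each step, against injectivity.
Applied to the whole module, this shows that a minimal cell has nonzero cycles in its lowest nonzero
degree. -/
theorem IsNilSub.proj_eq_zero (hpos : ∀ i < 0, 𝒜.gr i = ⊥) {M : DGModule 𝒜} {a : ℤ}
    (ha : ∀ i < a, M.gr i = ⊥) (hd : ∀ x ∈ M.gr a, M.d x = 0 → x = 0)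
    {Y : Submodule Aᵐᵒᵖ M.carrier} (hY : IsNilSub M Y) : ∀ y ∈ Y, M.proj a y = 0 := by
  induction hY with
  | base => exact fun y hy => proj_smulGE_eq_zero hpos ha (lt_add_one a) hy
  | @step Y Z _ _ hZ ih =>
    intro z hz
    refine hd _ (M.proj_mem a z) ?_
    rw [M.d_proj]
    obtain ⟨u, hu, v, hv, huv⟩ := Submodule.mem_sup.1 (hZ z hz)
    rw [← huv, map_add, proj_smulGE_eq_zero hpos ha (by omega) hv, add_zero]
    refine smulGE_induction hpos (P := fun u => M.proj (a + 1) u = 0) (map_zero _)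
      (fun x y hx hy => by rw [map_add, hx, hy, add_zero]) (fun j hj c hc y hy => ?_) hu
    have h1 := M.smul_proj hc (a + 1 - j) y
    rw [sub_add_cancel] at h1
    rw [← h1]
    by_cases hj1 : j = 1
    · rw [hj1, add_sub_cancel_right, ih y hy, smul_zero]
    · rw [proj_eq_zero_of_lt ha (by omega), smul_zero]

/-- A filtration as in the definition of `dgFilt(𝒜)` with generators in degrees `≥ a`. -/
def IsFiltGE (h0 : ∀ a ∈ 𝒜.gr 0, 𝒜.d a = 0) (M : DGModule 𝒜) (a : ℤ) : Prop :=
  ∃ (n : ℕ) (F : Fin (n + 1) → DGSub M) (l : Fin n → ℤ),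
    (F 0).toSubmodule = ⊥ ∧ (F (Fin.last n)).toSubmodule = ⊤ ∧ Antitone l ∧ (∀ i, l i ≤ -a) ∧
    ∀ i : Fin n, (F i.castSucc).toSubmodule ≤ (F i.succ).toSubmodule ∧
      ∃ (L : Type u) (_ : AddCommGroup L) (_ : Module 𝒜.A0ᵐᵒᵖ L),
        IsSimpleModule 𝒜.A0ᵐᵒᵖ L ∧
        Iso (subquot (F i.castSucc) (F i.succ)) (DGModule.shift (l i) (hat h0 L))

/-- The image of a morphism. -/
def Hom.range {M N : DGModule 𝒜} (f : Hom M N) : DGSub N where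
  toSubmodule := LinearMap.range f.toLin
  proj_mem := by
    rintro i _ ⟨x, rfl⟩
    exact ⟨M.proj i x, f.map_proj i x⟩
  d_mem := by
    rintro _ ⟨x, rfl⟩
    exact ⟨M.d x, f.map_d x⟩

/-- The projection to a quotient. -/
def quotMk {M : DGModule 𝒜} (S : DGSub M) : Hom M (M.quot S) where
  toLin := S.toSubmodule.mkQ
  map_mem _ m hm := ⟨m, hm, rfl⟩
  map_d _ := rfl

/-- The inverse image of a dg submodule. -/
def DGSub.comap {M N : DGModule 𝒜} (f : Hom M N) (S : DGSub N) : DGSub M where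
  toSubmodule := S.toSubmodule.comap f.toLin
  proj_mem i m hm := by
    rw [Submodule.mem_comap] at hm ⊢
    rw [f.map_proj]
    exact S.proj_mem i _ hm
  d_mem m hm := by
    rw [Submodule.mem_comap] at hm ⊢
    rw [f.map_d]
    exact S.d_mem _ hm

/-- The zero submodule. -/
def DGSub.bot (M : DGModule 𝒜) : DGSub M where
  toSubmodule := ⊥
  proj_mem i m hm := by rw [(Submodule.mem_bot _).1 hm, map_zero]; exact zero_mem _
  d_mem m hm := by rw [(Submodule.mem_bot _).1 hm, map_zero]; exact zero_mem _

/-- Extension of a filtration of `M / S` by a first step `S`. -/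
theorem IsFiltGE.extend {h0 : ∀ a ∈ 𝒜.gr 0, 𝒜.d a = 0} {M Q : DGModule 𝒜} {a : ℤ}
    (L : Type u) [AddCommGroup L] [Module 𝒜.A0ᵐᵒᵖ L] (hL : IsSimpleModule 𝒜.A0ᵐᵒᵖ L)
    (J : Hom (DGModule.shift (-a) (hat h0 L)) M) (hJ : Function.Injective J.toLin) (q : Hom M Q)
    (hq : Function.Surjective q.toLin) (hex : ∀ x, q.toLin x = 0 ↔ ∃ y, J.toLin y = x)
    (hQ : Q.IsFiltGE h0 a) : M.IsFiltGE h0 a := by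
  obtain ⟨n, F, l, hbot, htop, hl, hla, hF⟩ := hQ
  refine ⟨n + 1, Fin.cons (DGSub.bot M) fun i => (F i).comap q, Fin.cons (-a) l, rfl, ?_, ?_, ?_,
    ?_⟩
  · rw [← Fin.succ_last, Fin.cons_succ]
    change (F (Fin.last n)).toSubmodule.comap q.toLin = ⊤
    rw [htop, Submodule.comap_top]
  · intro i j hij
    cases j using Fin.cases with
    | zero =>
      have : i = 0 := le_antisymm hij (Fin.zero_le i)
      rw [this]
    | succ j =>
      cases i using Fin.cases with
      | zero => simpa using hla j
      | succ i => simpa using hl (Fin.succ_le_succ_iff.1 hij)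
  · intro i
    cases i using Fin.cases with
    | zero => simp
    | succ i => simpa using hla i
  · intro i
    cases i using Fin.cases with
    | zero =>
      simp only [Fin.castSucc_zero, Fin.cons_zero, Fin.cons_succ]
      refine ⟨bot_le, L, _, _, hL, ?_⟩
      have hmem : ∀ y, J.toLin y ∈ ((F 0).comap q).toSubmodule := fun y => by
        change q.toLin (J.toLin y) ∈ (F 0).toSubmodule
        rw [hbot, Submodule.mem_bot]
        exact (hex _).2 ⟨y, rfl⟩
      let J' : Hom (DGModule.shift (-a) (hat h0 L)) ((F 0).comap q).toDGModule :=
        { toLin := J.toLin.codRestrict _ hmem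
          map_mem := fun i m hm => J.map_mem i m hm
          map_d := fun m => Subtype.ext (J.map_d m) }
      let J'' := (subquotMk (DGSub.bot M) ((F 0).comap q)).comp J'
      refine Iso.symm ⟨J'', J''.isIso_of_bijective ⟨?_, fun z => ?_⟩⟩
      · refine (injective_iff_map_eq_zero J''.toLin).2 fun y hy => ?_
        have h1 := (subquotMk_eq_zero _ _ _).1 hy
        exact hJ (((Submodule.mem_bot _).1 h1).trans (map_zero J.toLin).symm)
      · obtain ⟨⟨x, hx⟩, rfl⟩ := subquotMk_surjective _ _ z
        have hx' : q.toLin x ∈ (F 0).toSubmodule := hx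
        rw [hbot, Submodule.mem_bot] at hx'
        obtain ⟨y, rfl⟩ := (hex x).1 hx'
        exact ⟨y, rfl⟩
    | succ i =>
      simp only [Fin.castSucc_succ, Fin.cons_succ]
      obtain ⟨hle, L', i1, i2, hL', hiso⟩ := hF i
      refine ⟨Submodule.comap_mono hle, L', i1, i2, hL', Iso.trans ?_ hiso⟩
      let q' : Hom ((F i.succ).comap q).toDGModule (F i.succ).toDGModule :=
        { toLin := q.toLin.restrict fun x hx => hx
          map_mem := fun j m hm => q.map_mem j m.1 hm
          map_d := fun m => Subtype.ext (q.map_d m.1) }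
      refine subquot_iso _ _ ((subquotMk _ _).comp q') ?_ fun x => ?_
      · refine (subquotMk_surjective _ _).comp fun z => ?_
        obtain ⟨x, hx⟩ := hq z.1
        exact ⟨⟨x, by
          change q.toLin x ∈ (F i.succ).toSubmodule
          rw [hx]; exact z.2⟩, Subtype.ext hx⟩
      · exact subquotMk_eq_zero _ _ (q'.toLin x)

/-- The lowest degree part of a minimal cell contains a simple module of cycles. -/
theorem IsMinimalCell.exists_simple_cycles (hpos : ∀ i < 0, 𝒜.gr i = ⊥)
    (hss : IsSemisimpleRing 𝒜.A0) (h0 : ∀ a ∈ 𝒜.gr 0, 𝒜.d a = 0) {M : DGModule 𝒜}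
    (hM : IsMinimalCell M) {a : ℤ} (ha : ∀ i < a, M.gr i = ⊥) (hne : M.gr a ≠ ⊥) :
    ∃ (L : Type u) (_ : AddCommGroup L) (_ : Module 𝒜.A0ᵐᵒᵖ L) (φ : L →ₗ[𝒜.A0ᵐᵒᵖ] M.carrier),
      IsSimpleModule 𝒜.A0ᵐᵒᵖ L ∧ Function.Injective φ ∧ ∀ l, φ l ∈ M.gr a ∧ M.d (φ l) = 0 := by
  let C : Submodule 𝒜.A0ᵐᵒᵖ M.carrier :=
    { carrier := {x | x ∈ M.gr a ∧ M.d x = 0}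
      add_mem' := fun hx hy => ⟨add_mem hx.1 hy.1, by rw [map_add, hx.2, hy.2, add_zero]⟩
      zero_mem' := ⟨zero_mem _, map_zero _⟩
      smul_mem' := fun r x hx => by
        have h1 := M.smul_mem a 0 x _ hx.1 (𝒜.A0incl_mem r.unop)
        rw [add_zero] at h1
        refine ⟨h1, ?_⟩
        rw [A0_smul_def, M.leibniz a x _ hx.1, hx.2, h0 _ (𝒜.A0incl_mem _)]
        simp }
  have hC : Nontrivial C := by
    by_contra hC
    rw [not_nontrivial_iff_subsingleton] at hC
    apply hne
    rw [eq_bot_iff]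
    intro x hx
    rw [AddSubgroup.mem_bot, ← M.proj_same hx]
    refine hM.nil.proj_eq_zero hpos ha (fun x hx hdx => ?_) x Submodule.mem_top
    exact congrArg Subtype.val (Subsingleton.elim (⟨x, hx, hdx⟩ : C) 0)
  obtain ⟨L, hL⟩ := IsSemisimpleModule.exists_simple_submodule 𝒜.A0ᵐᵒᵖ C
  exact ⟨L, inferInstance, inferInstance, C.subtype.comp L.subtype, hL,
    Subtype.val_injective.comp Subtype.val_injective, fun l => l.1.2⟩

theorem barLength_quot_add_one_le {M Q : DGModule 𝒜} (q : Hom M Q)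
    (hq : Function.Surjective q.toLin) {x : M.carrier} (hx : x ∉ M.smulGE ⊤ 1)
    (hqx : q.toLin x = 0) : Q.barLength + 1 ≤ M.barLength := by
  let f := restrictA0 (barMap q.toLin)
  have hf : ∀ x, f (M.barMk x) = Q.barMk (q.toLin x) := fun _ => rfl
  have hs : Function.Surjective f := fun z => by
    obtain ⟨z, rfl⟩ := Q.barMk_surjective z
    obtain ⟨y, rfl⟩ := hq z
    exact ⟨_, hf y⟩
  have h1 := Module.length_eq_add_of_exact (LinearMap.ker f).subtype f Subtype.val_injective hs
    (LinearMap.exact_subtype_ker_map f)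
  have h2 : Nontrivial (LinearMap.ker f) := by
    refine ⟨⟨⟨M.barMk x, ?_⟩, 0, fun h => hx ?_⟩⟩
    · rw [LinearMap.mem_ker, hf, hqx, map_zero]
    · exact barMk_eq_zero.1 (congrArg Subtype.val h)
  have h3 := Module.length_pos (R := 𝒜.A0ᵐᵒᵖ) (M := LinearMap.ker f)
  change _ ≤ Module.length 𝒜.A0ᵐᵒᵖ M.bar.carrier
  rw [h1, add_comm]
  exact add_le_add_left (Order.one_le_iff_pos.2 h3) _

/-- Splitting off the lowest step of a minimal cell. -/
theorem IsMinimalCell.exists_quot (hpos : ∀ i < 0, 𝒜.gr i = ⊥)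
    (hss : IsSemisimpleRing 𝒜.A0) (h0 : ∀ a ∈ 𝒜.gr 0, 𝒜.d a = 0) {M : DGModule 𝒜}
    (hM : IsMinimalCell M) {a : ℤ} (ha : ∀ i < a, M.gr i = ⊥) (hne : M.gr a ≠ ⊥) :
    ∃ (L : Type u) (_ : AddCommGroup L) (_ : Module 𝒜.A0ᵐᵒᵖ L)
      (J : Hom (DGModule.shift (-a) (hat h0 L)) M),
      IsSimpleModule 𝒜.A0ᵐᵒᵖ L ∧ Function.Injective J.toLin ∧
      IsMinimalCell (M.quot J.range) ∧ (M.quot J.range).barLength + 1 ≤ M.barLength := by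
  obtain ⟨L, _, _, φ, hL, hinj, hφ⟩ := hM.exists_simple_cycles hpos hss h0 ha hne
  obtain ⟨j, hj⟩ := exists_hatLift h0 (N := M) φ.toAddMonoidHom
    fun r l => φ.map_smul (MulOpposite.op r) l
  replace hj : ∀ l, j (hatIncl h0 L l) = φ l := hj
  let J : Hom (DGModule.shift (-a) (hat h0 L)) M :=
    { toLin := j
      map_mem := fun i m hm => by
        have := hat_map_mem h0 j a (fun l => by rw [hj]; exact (hφ l).1) _ m hm
        rwa [neg_add_cancel_right] at this
      map_d := hat_induction h0
        (P := fun m => j ((-a).negOnePow • (hat h0 L).d m) = M.d (j m)) (by simp)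
        (fun x y hx hy => by simp only [map_add, smul_add, hx, hy])
        (fun i c hc l => by
          rw [map_smul j (MulOpposite.op c), hj, M.leibniz a _ c (hφ l).1, (hφ l).2,
            (hat h0 L).leibniz 0 _ c (hatIncl_mem h0 l), d_hatIncl, Int.negOnePow_neg]
          rcases Int.units_eq_one_or a.negOnePow with h | h <;> simp [h, hj]) }
  -- The reduction of `j` is injective: `M A^+` has nothing in the lowest degree `a`, whereas `L`
  -- embeds there.
  have hker : ∀ y, j y ∈ M.smulGE ⊤ 1 → y ∈ (hat h0 L).smulGE ⊤ 1 := by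
    intro y hy
    obtain ⟨l, hl⟩ := exists_sub_hatIncl_mem h0 hpos y
    have h1 := sub_mem hy (map_mem_smulGE_top j hl)
    rw [map_sub, sub_sub_cancel, hj] at h1
    have h2 := proj_smulGE_eq_zero hpos ha (lt_add_one a) h1
    rw [M.proj_same (hφ l).1] at h2
    rw [hinj (h2.trans (map_zero φ).symm), map_zero, sub_zero] at hl
    exact hl
  obtain ⟨Ψ, hΨ, -⟩ := exists_quasi_inverse (P := DGModule.shift (-a) (hat h0 L)) hpos hss
    hM.projective (M.smulGE ⊤ 1) le_rfl J.toLin.toAddMonoidHom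
    (fun r x => by
      change J.toLin (MulOpposite.op (𝒜.A0incl r.unop) • x) -
        MulOpposite.op (𝒜.A0incl r.unop) • J.toLin x ∈ _
      rw [map_smul, sub_self]; exact zero_mem _)
    (fun x hx => map_mem_smulGE_top J.toLin hx)
  have hΨ' : ∀ y, Ψ (J.toLin y) - y ∈ (DGModule.shift (-a) (hat h0 L)).smulGE ⊤ 1 := fun y => by
    refine hker (Ψ (J.toLin y) - y) ?_
    change J.toLin (Ψ (J.toLin y) - y) ∈ M.smulGE ⊤ 1
    rw [map_sub]
    exact hΨ y
  obtain ⟨g, hgdeg, hg⟩ := exists_component Ψ 0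
  -- The degree zero component `g` of `Ψ` satisfies `g J = 1` modulo `A^+`, so `g J` is invertible
  -- by Nakayama. Thus `J` splits `A`-linearly, though not compatibly with `d`, and the quotient is
  -- projective.
  have hbij : Function.Bijective (g.comp J.toLin) := by
    refine bijective_of_sub_mem hpos ⟨a, fun i hi => ?_⟩ _ (fun i m hm => ?_) fun x => ?_
    · exact hat_gr_eq_bot h0 hpos _ (by omega)
    · have := hgdeg i _ (J.map_mem i m hm)
      rwa [add_zero] at this
    · refine (DGModule.shift (-a) (hat h0 L)).induction (P := fun x => (g.comp J.toLin) x - x ∈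
        (DGModule.shift (-a) (hat h0 L)).smulGE ⊤ 1) (by simp) (fun i m hm => ?_)
        (fun x y hx hy => ?_) x
      · have h1 := proj_mem_smulGE hpos i (hΨ' m)
        rw [map_sub, proj_same _ hm] at h1
        rw [LinearMap.comp_apply, hg i _ (J.map_mem i m hm), add_zero]
        exact h1
      · rw [map_add, add_sub_add_comm]; exact add_mem hx hy
  let β := LinearEquiv.ofBijective _ hbij
  have hβ : ∀ y, β.symm (g (J.toLin y)) = y := β.symm_apply_apply
  let θ : M.carrier →ₗ[Aᵐᵒᵖ] M.carrier :=
    LinearMap.id - (J.toLin.comp β.symm.toLinearMap).comp g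
  have hθ : ∀ x, θ x = x - J.toLin (β.symm (g x)) := fun _ => rfl
  have hfin := hM.finite
  have hproj := hM.projective
  let q := quotMk J.range
  have hq : Function.Surjective q.toLin := Submodule.mkQ_surjective _
  have hqJ : ∀ y, q.toLin (J.toLin y) = 0 := fun y =>
    (Submodule.Quotient.mk_eq_zero J.range.toSubmodule).2 ⟨y, rfl⟩
  let s : (M.quot J.range).carrier →ₗ[Aᵐᵒᵖ] M.carrier := Submodule.liftQ _ θ (by
    rintro _ ⟨y, rfl⟩
    rw [LinearMap.mem_ker, hθ, hβ, sub_self])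
  have hs : ∀ x, s (q.toLin x) = θ x := fun _ => rfl
  refine ⟨L, _, _, J, hL, Function.Injective.of_comp (f := g) hbij.1,
    ⟨Module.Finite.of_surjective q.toLin hq, Module.Projective.of_split s q.toLin ?_, ?_, ?_⟩, ?_⟩
  · refine LinearMap.ext fun z => ?_
    obtain ⟨x, rfl⟩ := hq z
    rw [LinearMap.comp_apply, hs, hθ, map_sub, hqJ, sub_zero, LinearMap.id_apply]
  · intro z
    obtain ⟨x, rfl⟩ := hq z
    rw [← q.map_d]
    exact map_mem_smulGE_top q.toLin (hM.minimal x)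
  · have h1 := hM.nil.map q hq
    rwa [Submodule.map_top, LinearMap.range_eq_top.2 hq] at h1
  · have := IsSimpleModule.nontrivial 𝒜.A0ᵐᵒᵖ L
    obtain ⟨l, hl⟩ := exists_ne (0 : L)
    refine barLength_quot_add_one_le q hq (x := φ l) (fun h1 => hl ?_) ?_
    · have h2 := proj_smulGE_eq_zero hpos ha (lt_add_one a) h1
      rw [M.proj_same (hφ l).1] at h2
      exact hinj (h2.trans (map_zero φ).symm)
    · rw [← hj]
      exact hqJ _

theorem isFiltGE_of_gr_eq_bot (h0 : ∀ a ∈ 𝒜.gr 0, 𝒜.d a = 0) {M : DGModule 𝒜}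
    (hz : ∀ i, M.gr i = ⊥) (a : ℤ) : M.IsFiltGE h0 a := by
  have h1 : ∀ x : M.carrier, x = 0 := fun x =>
    eq_zero_of_proj fun i => proj_eq_zero_of_lt (a := i + 1) (fun i _ => hz i) (by omega) x
  exact ⟨0, fun _ => DGSub.bot M, Fin.elim0, rfl, eq_top_iff.2 fun x _ => h1 x,
    fun i => i.elim0, fun i => i.elim0, fun i => i.elim0⟩

theorem IsMinimalCell.isFiltGE (hpos : ∀ i < 0, 𝒜.gr i = ⊥) (hss : IsSemisimpleRing 𝒜.A0)
    (h0 : ∀ a ∈ 𝒜.gr 0, 𝒜.d a = 0) (n : ℕ) : ∀ (M : DGModule 𝒜), IsMinimalCell M →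
    M.barLength ≤ n → ∀ a, (∀ i < a, M.gr i = ⊥) → M.IsFiltGE h0 a := by
  induction n with
  | zero =>
    intro M hM hn a ha
    by_cases hz : ∀ i, M.gr i = ⊥
    · exact isFiltGE_of_gr_eq_bot h0 hz a
    · push Not at hz
      obtain ⟨b, hb, hmin⟩ := Int.exists_least_of_bdd (P := fun i => M.gr i ≠ ⊥)
        ⟨a, fun z hz => by by_contra h; exact hz (ha z (by omega))⟩ hz
      obtain ⟨L, _, _, J, _, _, _, hl⟩ := hM.exists_quot hpos hss h0 (a := b)
        (fun i hi => by by_contra h; exact absurd (hmin i h) (by omega)) hb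
      have := hl.trans hn
      simp at this
  | succ n ih =>
    intro M hM hn a ha
    by_cases hz : ∀ i, M.gr i = ⊥
    · exact isFiltGE_of_gr_eq_bot h0 hz a
    · push Not at hz
      obtain ⟨b, hb, hmin⟩ := Int.exists_least_of_bdd (P := fun i => M.gr i ≠ ⊥)
        ⟨a, fun z hz => by by_contra h; exact hz (ha z (by omega))⟩ hz
      have hbelow : ∀ i < b, M.gr i = ⊥ := fun i hi => by
        by_contra h; exact absurd (hmin i h) (by omega)
      obtain ⟨L, _, _, J, hL, hJ, hQ, hl⟩ := hM.exists_quot hpos hss h0 hbelow hb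
      have hab : a ≤ b := by
        by_contra h; exact hb (ha b (by omega))
      have h1 := ih _ hQ (by
        have := hl.trans hn
        rw [Nat.cast_add, Nat.cast_one] at this
        exact (ENat.add_le_add_iff_right ENat.one_ne_top).1 this) b fun i hi => by
          change (M.gr i).map _ = ⊥
          rw [hbelow i hi, AddSubgroup.map_bot]
      -- The first step uses the exact lowest degree `b`. The quotient still vanishes below `b`, so
      -- its shifts are at most `-b` and the sequence stays antitone.
      obtain ⟨m, F, l, e1, e2, e3, e4, e5⟩ := IsFiltGE.extend L hL J hJ (quotMk J.range)
        (Submodule.mkQ_surjective _)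
        (fun x => Submodule.Quotient.mk_eq_zero J.range.toSubmodule) h1
      exact ⟨m, F, l, e1, e2, e3, fun i => (e4 i).trans (by omega), e5⟩

theorem IsMinimalCell.isFilt (hpos : ∀ i < 0, 𝒜.gr i = ⊥) (hss : IsSemisimpleRing 𝒜.A0)
    (h0 : ∀ a ∈ 𝒜.gr 0, 𝒜.d a = 0) {M : DGModule 𝒜} (hM : IsMinimalCell M) : M.IsFilt h0 := by
  obtain ⟨a, ha⟩ := isBoundedBelow_of_finite hpos hM.finite
  obtain ⟨n, hn⟩ := ENat.ne_top_iff_exists.1 (barLength_ne_top hpos hss hM.finite)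
  obtain ⟨m, F, l, e1, e2, e3, _, e5⟩ := hM.isFiltGE hpos hss h0 n M hn.ge a ha
  exact ⟨m, F, l, e1, e2, e3, e5⟩

/-! ### Lengths -/

/-- Homotopies are `A`-linear and so descend to reductions; a retract in `dgHot` thus gives an
injection on the cohomology of the reductions. -/
theorem IsHomotopyRetract.barHLength_le {M N : DGModule 𝒜} (h : IsHomotopyRetract M N) :
    M.barHLength ≤ N.barHLength := by
  obtain ⟨i, p, h, hdeg, hh⟩ := h
  have hbd : ∀ {P Q : DGModule 𝒜} (f : Hom P Q) (x : P.bar.carrier),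
      restrictA0 (barMap f.toLin) (P.barD x) = Q.barD (restrictA0 (barMap f.toLin) x) := by
    intro P Q f x
    obtain ⟨x, rfl⟩ := P.barMk_surjective x
    exact congrArg Q.barMk (f.map_d x)
  let κ : LinearMap.ker M.barD →ₗ[𝒜.A0ᵐᵒᵖ] LinearMap.ker N.barD :=
    (restrictA0 (barMap i.toLin)).restrict fun x hx => by
      rw [LinearMap.mem_ker] at hx ⊢
      rw [← hbd, hx, map_zero]
  let f : M.barH →ₗ[𝒜.A0ᵐᵒᵖ] N.barH := Submodule.mapQ _ _ κ (by
    rintro x ⟨y, hy⟩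
    refine ⟨restrictA0 (barMap i.toLin) y, ?_⟩
    rw [← hbd, hy]
    rfl)
  refine Module.length_le_of_injective f ((injective_iff_map_eq_zero f).2 fun z hz => ?_)
  obtain ⟨x, rfl⟩ := Submodule.mkQ_surjective _ z
  have h1 : κ x ∈ (LinearMap.range N.barD).submoduleOf (LinearMap.ker N.barD) :=
    (Submodule.Quotient.mk_eq_zero _).1 hz
  obtain ⟨y, hy⟩ := h1
  replace hy : N.barD y = restrictA0 (barMap i.toLin) x.1 := hy
  refine (Submodule.Quotient.mk_eq_zero _).2 ?_
  change x.1 ∈ LinearMap.range M.barD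
  have h2 : ∀ x : M.bar.carrier, restrictA0 (barMap p.toLin) (restrictA0 (barMap i.toLin) x) - x =
      M.barD (restrictA0 (barMap h) x) + restrictA0 (barMap h) (M.barD x) := by
    intro x
    obtain ⟨x, rfl⟩ := M.barMk_surjective x
    exact congrArg M.barMk (hh x)
  have h3 := h2 x.1
  rw [← hy, hbd p, LinearMap.mem_ker.1 x.2, map_zero, add_zero, sub_eq_iff_eq_add'] at h3
  refine ⟨restrictA0 (barMap p.toLin) y - restrictA0 (barMap h) x.1, ?_⟩
  rw [map_sub, h3, add_sub_cancel_right]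

theorem HotIso.barHLength_eq {M N : DGModule 𝒜} (h : HotIso M N) :
    M.barHLength = N.barHLength :=
  le_antisymm h.isHomotopyRetract.barHLength_le h.symm.isHomotopyRetract.barHLength_le

theorem barHLength_le_ker (M : DGModule 𝒜) :
    M.barHLength ≤ Module.length 𝒜.A0ᵐᵒᵖ (LinearMap.ker M.barD) :=
  Module.length_le_of_surjective _ (Submodule.mkQ_surjective _)

theorem barHLength_le_barLength (M : DGModule 𝒜) : M.barHLength ≤ M.barLength :=
  M.barHLength_le_ker.trans
    (Module.length_le_of_injective (LinearMap.ker M.barD).subtype Subtype.val_injective)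

theorem barHLength_eq_of_barD_eq_zero {M : DGModule 𝒜} (h : ∀ x, M.bar.d x = 0) :
    M.barHLength = M.barLength := by
  refine le_antisymm M.barHLength_le_barLength ?_
  let f : M.bar.carrier →ₗ[𝒜.A0ᵐᵒᵖ] M.barH :=
    (Submodule.mkQ _).comp (LinearMap.codRestrict (LinearMap.ker M.barD) LinearMap.id h)
  refine Module.length_le_of_injective f ((injective_iff_map_eq_zero f).2 fun x hx => ?_)
  obtain ⟨y, hy⟩ := (Submodule.Quotient.mk_eq_zero _).1 hx
  exact hy.symm.trans (h y)

/-- The length of `M̄` is that of the kernel plus that of the image of its differential, and the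
kernel is at least as long as `H(M̄)`. Finiteness allows cancellation, so the image has length zero.
-/
theorem bar_d_eq_zero_of_length_eq {M : DGModule 𝒜} (hfin : M.barHLength ≠ ⊤)
    (h : M.barLength = M.barHLength) (x : M.bar.carrier) : M.bar.d x = 0 := by
  have h1 := Module.length_eq_add_of_exact (LinearMap.ker M.barD).subtype M.barD.rangeRestrict
    Subtype.val_injective M.barD.surjective_rangeRestrict (LinearMap.exact_iff.2 (by
      rw [LinearMap.ker_rangeRestrict, Submodule.range_subtype]))
  have h2 : Module.length 𝒜.A0ᵐᵒᵖ (LinearMap.range M.barD) = 0 := by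
    have h3 : M.barHLength + Module.length 𝒜.A0ᵐᵒᵖ (LinearMap.range M.barD) ≤
        M.barHLength + 0 := by
      rw [add_zero]
      calc _ ≤ _ := add_le_add_left M.barHLength_le_ker _
        _ = M.barLength := h1.symm
        _ = _ := h
    exact le_antisymm ((ENat.add_le_add_iff_left hfin).1 h3) bot_le
  rw [Module.length_eq_zero_iff] at h2
  exact congrArg Subtype.val (Subsingleton.elim (M.barD.rangeRestrict x) 0)

theorem bar_d_eq_zero_iff (M : DGModule 𝒜) :
    (∀ x, M.bar.d x = 0) ↔ ∀ m, M.d m ∈ M.mulAPlus.toSubmodule := by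
  refine ⟨fun h m => (Submodule.Quotient.mk_eq_zero M.mulAPlus.toSubmodule).1 (h (M.barMk m)),
    fun h x => ?_⟩
  obtain ⟨x, rfl⟩ := M.barMk_surjective x
  exact (Submodule.Quotient.mk_eq_zero M.mulAPlus.toSubmodule).2 (h x)

end DGModule

/-! ### Assembly of the equivalences. -/

theorem proposition7p2 {k : Type w} {A : Type u} [CommRing k] [Ring A] [Algebra k A]
    (𝒜 : DGAlgebra k A)
    (hpos : ∀ i < 0, 𝒜.gr i = ⊥)
    (hss : IsSemisimpleRing 𝒜.A0)
    (h0 : ∀ a ∈ 𝒜.gr 0, 𝒜.d a = 0)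
    (M : DGModule 𝒜) (hM : M.IsPerfect) :
    -- the equivalence of all seven conditions, for bounded below `M`
    (M.IsBoundedBelow → List.TFAE [
      M.IsFilt h0,
      M.IsHomotopicallyMinimal,
      ∀ i, ∀ m ∈ M.le i, M.d m ∈ M.le i,
      ∀ m, M.d m ∈ M.mulAPlus.toSubmodule,
      ∀ x, M.bar.d x = 0,
      M.barLength = M.barHLength,
      M.barLength ≠ ⊤ ∧ ∀ N : DGModule 𝒜, M.HotIso N → M.barLength ≤ N.barLength]) ∧
    -- what holds without any boundedness condition
    (M.IsFilt h0 ↔ M.IsHomotopicallyMinimal) ∧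
    List.TFAE [
      ∀ i, ∀ m ∈ M.le i, M.d m ∈ M.le i,
      ∀ m, M.d m ∈ M.mulAPlus.toSubmodule,
      ∀ x, M.bar.d x = 0,
      M.barLength = M.barHLength,
      M.barLength ≠ ⊤ ∧ ∀ N : DGModule 𝒜, M.HotIso N → M.barLength ≤ N.barLength] ∧
    (M.IsFilt h0 →
      M.IsBoundedBelow ∧ ∀ i, ∀ m ∈ M.le i, M.d m ∈ M.le i) := by
  obtain ⟨N, hN, hMN⟩ := hM.exists_hotIso hpos hss h0
  have hNd : ∀ x, N.bar.d x = 0 := (DGModule.bar_d_eq_zero_iff N).2 fun m => by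
    rw [DGModule.mulAPlus_eq]; exact hN.minimal m
  have hNlen := DGModule.barHLength_eq_of_barD_eq_zero hNd
  -- Perfection makes the cohomology of `M̄` finite even if `M̄` itself has infinite length.
  have hfin : M.barHLength ≠ ⊤ := by
    rw [hMN.barHLength_eq, hNlen]
    exact DGModule.barLength_ne_top hpos hss hN.finite
  have h34 : (∀ i, ∀ m ∈ M.le i, M.d m ∈ M.le i) ↔ ∀ m, M.d m ∈ M.mulAPlus.toSubmodule := by
    rw [DGModule.mulAPlus_eq]; exact DGModule.d_mem_le_iff hpos M
  have h45 := DGModule.bar_d_eq_zero_iff M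
  have h56 : (∀ x, M.bar.d x = 0) ↔ M.barLength = M.barHLength :=
    ⟨fun h => (DGModule.barHLength_eq_of_barD_eq_zero h).symm, DGModule.bar_d_eq_zero_of_length_eq hfin⟩
  have h67 : M.barLength = M.barHLength ↔
      M.barLength ≠ ⊤ ∧ ∀ N : DGModule 𝒜, M.HotIso N → M.barLength ≤ N.barLength := by
    refine ⟨fun h => ⟨h ▸ hfin, fun P hP => ?_⟩, fun h => ?_⟩
    · rw [h, hP.barHLength_eq]; exact P.barHLength_le_barLength
    · refine le_antisymm ?_ M.barHLength_le_barLength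
      -- The minimality in 7 is tested against the model `N`, whose reduction has differential zero.
      rw [hMN.barHLength_eq, hNlen]
      exact h.2 N hMN
  have h1b : M.IsFilt h0 → M.IsBoundedBelow ∧ ∀ i, ∀ m ∈ M.le i, M.d m ∈ M.le i := fun h =>
    ⟨h.isBoundedBelow hpos, (DGModule.d_mem_le_iff hpos M).2 (h.minimal hpos)⟩
  have h32 : M.IsBoundedBelow → (∀ i, ∀ m ∈ M.le i, M.d m ∈ M.le i) →
      M.IsHomotopicallyMinimal := fun hb h =>
    DGModule.isHomotopicallyMinimal hpos hb ((DGModule.d_mem_le_iff hpos M).1 h)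
  have h12 : M.IsFilt h0 ↔ M.IsHomotopicallyMinimal :=
    ⟨fun h => h32 (h1b h).1 (h1b h).2, fun h => (h.isMinimalCell hpos hN hMN).isFilt hpos hss h0⟩
  refine ⟨fun hb => ?_, h12, ?_, h1b⟩
  · tfae_have 1 ↔ 2 := h12
    tfae_have 1 → 3 := fun h => (h1b h).2
    tfae_have 3 → 2 := h32 hb
    tfae_have 3 ↔ 4 := h34
    tfae_have 4 ↔ 5 := h45.symm
    tfae_have 5 ↔ 6 := h56
    tfae_have 6 ↔ 7 := h67
    tfae_finish
  · tfae_have 1 ↔ 2 := h34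
    tfae_have 2 ↔ 3 := h45.symm
    tfae_have 3 ↔ 4 := h56
    tfae_have 4 ↔ 5 := h67
    tfae_finish
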